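/- **Conventions.** Spaces are over $\mathbb K=\mathbb R$ or $\mathbb C$, $\mathbb N=\{1,2,\dots\}$, and a projection is a bounded linear projection. $L(X,Y)$ is the space of bounded linear operators $X\to Y$, and $L(X)=L(X,X)$. The Banach–Mazur distance is $d(E,F)=\inf\|\psi\|\,\|\psi^{-1}\|$ over all isomorphisms $\psi:E\to F$. A subspace is $C$-complemented if there is a projection onto it of norm $\le C$. For $T\in L(X)$ and $n\in\mathbb N$ the approximation number is $a_n(T)=\inf\{\|T-S\| : S\in L(X),\ \operatorname{rank} S<n\}$. We put $0^0=1$ and $0^{-s}=\infty$ for $s>0$. For $C\ge 1$ and a non-decreasing $K:\mathbb N\to\mathbb N$, $(K,C)\text{-}ld(X,Y)(n)\in[0,\infty]$ is the infimum of $\infty$ and all numbers $f\ge 0$ such that for all subspaces $M\subset X$, $M_Y\subset Y$ of dimension at most $n$ there are $C$-complemented subspaces $N\supset M$ of $X$ and $N_Y\supset M_Y$ of $Y$ with $\dim N=\dim N_Y\le K(n)$ and $d(N,N_Y)\le f$. It is called finite if all its values at $n\in\mathbb N$ are finite. A Banach space $X$ has property (D) with a non-decreasing function $f_X:\mathbb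 N\to[0,\infty)$ and constants $d(X)\ge 0$, $D(X)>0$ if for every $n\in\mathbb N$, every $c$, every $n$-dimensional subspace $M\subset X$ and every projection $P$ of $X$ onto $M$ with $\|P\|\le c$, there are an $n$-dimensional subspace $N\subset X$ and a projection $Q$ of $X$ onto $N$ with $M\cap N=\{0\}$, $\|Q\|\le D(X)\,c^{d(X)}$, $PQ=QP=0$ and $d(M,N)\le f_X(n)$. **Theorem 2.8.** Let $X$ and $Y$ be separable reflexive Banach spaces, let $C\ge1$ and let $K:\mathbb N\to\mathbb N$ be non-decreasing such that $(K,C)\text{-}ld(X^*,Y^*)$ is finite, and let $T\in L(X)$ be compact. Let $(m_k)_{k\ge0}$ be a sequence of natural numbers with $m_0=2$ and $m_k\ge K(4m_{k-1}+2)+1$ for $k\in\mathbb N$. Let $0\le\alpha<1/4$, $0\le\beta<1/4$ and $C'>0$. Assume that $X$ and $Y$ have property (D) with functions $f_X$, $f_Y$ and constants $d(X),D(X)$ and $d(Y),D(Y)$, such that for all $k\in\mathbb N$ $$f_X(n)\le C'\,a_{m_{k-1}}(T)^{-\alpha},\qquad f_Y(n)\le C'\,a_{m_{k-1}}(T)^{-\beta}\qquad\text{for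 all } n\le m_{k+1}.\tag{2.16}$$ Put $d=\max\{d(X),d(Y),1\}$, $D=\max\{D(X),D(Y)\}$ and $C(k)=(4D(C+3))^{(k+1)d^k}$, and assume that for all $k\in\mathbb N$ $$(K,C)\text{-}ld(X^*,Y^*)(4m_{k+1})\le C'\,k^{-3/4}\,C(k+2)^{-5}\,a_{m_k}(T)^{(-1+4\max\{\alpha,\beta\})/4}.\tag{2.17}$$ Then there are $T^{(1)}\in L(X,Y)$ and $T^{(2)}\in L(Y,X)$, both compact, such that $T=T^{(2)}T^{(1)}$ and $T^{(1)}(X)$ is dense in $Y$. -/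

import Mathlib

open scoped NNReal ENNReal

namespace LocalDist

noncomputable section

universe u v w

variable (𝕜 : Type u) [RCLike 𝕜]

/-- A normed space is reflexive if the canonical embedding into its bidual is onto. -/
def IsReflexive (X : Type v) [NormedAddCommGroup X] [NormedSpace 𝕜 X] : Prop :=
  Function.Surjective (NormedSpace.inclusionInDoubleDual 𝕜 X)

/-- The Banach-Mazur distance `inf ‖ψ‖ ‖ψ⁻¹‖` over all isomorphisms `ψ`; it is `∞` if there is no
isomorphism. -/
def banachMazur (E : Type v) (F : Type w) [NormedAddCommGroup E] [NormedSpace 𝕜 E]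
    [NormedAddCommGroup F] [NormedSpace 𝕜 F] : ℝ≥0∞ :=
  ⨅ ψ : E ≃L[𝕜] F, ENNReal.ofReal (‖(ψ : E →L[𝕜] F)‖ * ‖(ψ.symm : F →L[𝕜] E)‖)

variable {𝕜}

/-- `M` is `C`-complemented in `X`: there is a bounded projection of `X` onto `M` of norm at
most `C`. -/
def IsComplementedBy {X : Type v} [NormedAddCommGroup X] [NormedSpace 𝕜 X]
    (C : ℝ) (M : Submodule 𝕜 X) : Prop :=
  ∃ P : X →L[𝕜] X, LinearMap.IsProj M P ∧ ‖P‖ ≤ C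

variable (𝕜)

/-- The condition on a number `f` in the definition of the `K`-uniform `C`-local distance at `n`:
any two subspaces of dimension at most `n` are contained in `C`-complemented subspaces of the same
dimension, which is at most `K n`, whose Banach-Mazur distance is at most `f`. -/
def LocalDistBound (K : ℕ → ℕ) (C : ℝ) (X : Type v) (Y : Type w)
    [NormedAddCommGroup X] [NormedSpace 𝕜 X] [NormedAddCommGroup Y] [NormedSpace 𝕜 Y]
    (n : ℕ) (f : ℝ≥0) : Prop :=
  ∀ (M : Submodule 𝕜 X) (M' : Submodule 𝕜 Y),
    FiniteDimensional 𝕜 M → FiniteDimensional 𝕜 M' →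
    Module.finrank 𝕜 M ≤ n → Module.finrank 𝕜 M' ≤ n →
    ∃ (N : Submodule 𝕜 X) (N' : Submodule 𝕜 Y),
      FiniteDimensional 𝕜 N ∧ FiniteDimensional 𝕜 N' ∧
      IsComplementedBy C N ∧ IsComplementedBy C N' ∧
      M ≤ N ∧ M' ≤ N' ∧
      Module.finrank 𝕜 N = Module.finrank 𝕜 N' ∧ Module.finrank 𝕜 N ≤ K n ∧
      banachMazur 𝕜 N N' ≤ (f : ℝ≥0∞)

/-- The `K`-uniform `C`-local distance function `(K,C)-ld(X,Y)` at `n`, with values in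
`[0, ∞]`. -/
def localDist (K : ℕ → ℕ) (C : ℝ) (X : Type v) (Y : Type w)
    [NormedAddCommGroup X] [NormedSpace 𝕜 X] [NormedAddCommGroup Y] [NormedSpace 𝕜 Y]
    (n : ℕ) : ℝ≥0∞ :=
  ⨅ (f : ℝ≥0) (_ : LocalDistBound 𝕜 K C X Y n f), (f : ℝ≥0∞)

/-- Property (D) of `X` with the non-decreasing function `f` (on the positive integers) and the
constants `d ≥ 0` and `D > 0`. -/
structure PropertyD (X : Type v) [NormedAddCommGroup X] [NormedSpace 𝕜 X]
    (f : ℕ → ℝ≥0) (d D : ℝ) : Prop where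
  mono : MonotoneOn f (Set.Ici 1)
  d_nonneg : 0 ≤ d
  D_pos : 0 < D
  exists_copy : ∀ (n : ℕ), 1 ≤ n → ∀ (c : ℝ) (M : Submodule 𝕜 X) (P : X →L[𝕜] X),
    FiniteDimensional 𝕜 M → Module.finrank 𝕜 M = n → LinearMap.IsProj M P → ‖P‖ ≤ c →
    ∃ (N : Submodule 𝕜 X) (Q : X →L[𝕜] X),
      FiniteDimensional 𝕜 N ∧ Module.finrank 𝕜 N = n ∧ LinearMap.IsProj N Q ∧
      M ⊓ N = ⊥ ∧
      ‖Q‖ ≤ D * c ^ d ∧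
      P ∘L Q = 0 ∧ Q ∘L P = 0 ∧
      banachMazur 𝕜 M N ≤ (f n : ℝ≥0∞)

variable {𝕜}

/-- The `n`-th approximation number `a_n(T)`, `n ≥ 1`, as an element of `[0, ∞]` (it is at most
`‖T‖`), so that `a_n(T) ^ (-s) = ∞` for `s > 0` when `a_n(T) = 0`. -/
def approxNumber {X : Type v} {Y : Type w} [NormedAddCommGroup X] [NormedSpace 𝕜 X]
    [NormedAddCommGroup Y] [NormedSpace 𝕜 Y] (T : X →L[𝕜] Y) (n : ℕ) : ℝ≥0∞ :=
  ⨅ (S : X →L[𝕜] Y) (_ : LinearMap.rank (S : X →ₗ[𝕜] Y) < (n : Cardinal)), ‖T - S‖ₑ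

/-- The numbers `C(k) = (4 D (C + 3)) ^ ((k + 1) d ^ k)`. -/
def growthConst (C d D : ℝ) (k : ℕ) : ℝ :=
  (4 * D * (C + 3)) ^ (((k : ℝ) + 1) * d ^ k)

end

end LocalDist

/-! The compact operator is cut into finite-rank pieces, and each piece is sent through its own part
of `Y`. Finite local distance of the duals, read back through reflexivity, gives idempotents `p k`
on `X` of norm at most `C` that factor through `Y` and satisfy `p k ∘ p (k + 1) = p k` and `G k ∘ p
k = G k`, where `G k` is a finite-rank operator nearly attaining the approximation number at `m k`.
Hence `T ∘ p k → T`, and `T` is the telescoping sum of the operators `T (1 - p k) p (k + 1)`.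

Property (D) of `Y` moves the factorization `p (k + 1) = j k ∘ i k` onto the range of a projection
`Q k` orthogonal to all earlier ones (`exists_orthogonal_factorization`). With weights `t k * s k =
1`, set `A = ∑ s k • i k` and `S = ∑ t k • T (1 - p k) j k`. Orthogonality kills the cross terms, so
`S ∘ A = T`.

The sums converge because `‖T (1 - p k)‖ ≤ (1 + C) ‖T - G k‖` is about the size of the approximation
number, whereas `‖i k‖ ‖j k‖` is controlled by the local distance, the function of property (D) and
the norms of the accumulated projections. The growth hypotheses bound the product by a multiple of
`4⁻ᵏ`, which is split evenly between the two factors.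

Dense range comes from Baire category. The pairs of compact factors with product `T` and `S Y ⊆
closure (T X)` form a complete metric space. Small rank-one perturbations bring any given vector
arbitrarily near the range of `A`, so coming within `1 / (n + 1)` of a given vector is an open dense
condition; countably many such conditions force density. -/

namespace LocalDist

open Module

universe u v w

variable {𝕜 : Type u} [RCLike 𝕜]


/-! ### Finite-rank operators. -/

section Rank

variable {E F G : Type*} [NormedAddCommGroup E] [NormedSpace 𝕜 E] [NormedAddCommGroup F]
  [NormedSpace 𝕜 F] [NormedAddCommGroup G] [NormedSpace 𝕜 G]

/-- The operator `f` has finite rank, at most `n`. -/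
def RankLE (f : E →L[𝕜] F) (n : ℕ) : Prop :=
  FiniteDimensional 𝕜 (LinearMap.range (f : E →ₗ[𝕜] F)) ∧
    finrank 𝕜 (LinearMap.range (f : E →ₗ[𝕜] F)) ≤ n

theorem RankLE.mono {f : E →L[𝕜] F} {m n : ℕ} (h : RankLE f m) (hmn : m ≤ n) : RankLE f n :=
  ⟨h.1, h.2.trans hmn⟩

theorem rankLE_zero (n : ℕ) : RankLE (0 : E →L[𝕜] F) n := by
  have h : LinearMap.range ((0 : E →L[𝕜] F) : E →ₗ[𝕜] F) = ⊥ := by simp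
  unfold RankLE
  rw [h]
  exact ⟨inferInstance, by simp⟩

theorem RankLE.of_range_le {f : E →L[𝕜] F} {S : Submodule 𝕜 F} [FiniteDimensional 𝕜 S] {n : ℕ}
    (hS : finrank 𝕜 S ≤ n) (h : ∀ x, f x ∈ S) : RankLE f n := by
  have h' : LinearMap.range (f : E →ₗ[𝕜] F) ≤ S := by
    rintro _ ⟨x, rfl⟩
    exact h x
  exact ⟨Submodule.finiteDimensional_of_le h', (Submodule.finrank_mono h').trans hS⟩

theorem RankLE.comp_left {g : F →L[𝕜] G} {n : ℕ} (h : RankLE g n) (f : E →L[𝕜] F) :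
    RankLE (g ∘L f) n := by
  have := h.1
  exact .of_range_le h.2 fun x => ⟨f x, rfl⟩

theorem RankLE.comp_right {f : E →L[𝕜] F} {n : ℕ} (h : RankLE f n) (g : F →L[𝕜] G) :
    RankLE (g ∘L f) n := by
  have := h.1
  refine .of_range_le (S := (LinearMap.range (f : E →ₗ[𝕜] F)).map (g : F →ₗ[𝕜] G))
    ((Submodule.finrank_map_le _ _).trans h.2) fun x => ⟨f x, ⟨x, rfl⟩, rfl⟩

theorem RankLE.add {f g : E →L[𝕜] F} {m n : ℕ} (hf : RankLE f m) (hg : RankLE g n) :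
    RankLE (f + g) (m + n) := by
  have := hf.1
  have := hg.1
  refine .of_range_le (S := LinearMap.range (f : E →ₗ[𝕜] F) ⊔ LinearMap.range (g : E →ₗ[𝕜] F))
    ((Submodule.finrank_add_le_finrank_add_finrank _ _).trans (add_le_add hf.2 hg.2)) fun x => ?_
  exact Submodule.add_mem_sup ⟨x, rfl⟩ ⟨x, rfl⟩

theorem RankLE.isCompactOperator {f : E →L[𝕜] F} {n : ℕ} (h : RankLE f n) :
    IsCompactOperator f := by
  have := h.1
  have := FiniteDimensional.proper_rclike 𝕜 (LinearMap.range (f : E →ₗ[𝕜] F))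
  let f' : E →L[𝕜] LinearMap.range (f : E →ₗ[𝕜] F) := f.codRestrict _ fun x => ⟨x, rfl⟩
  have h1 : IsCompactOperator f' := isCompactOperator_of_locallyCompactSpace_dom f'
  exact h1.clm_comp (LinearMap.range (f : E →ₗ[𝕜] F)).subtypeL

theorem isCompactOperator_smulRight (c : StrongDual 𝕜 E) (y : F) :
    IsCompactOperator (c.smulRight y : E →L[𝕜] F) :=
  RankLE.isCompactOperator (n := 1) <| .of_range_le (S := 𝕜 ∙ y) (finrank_span_le_card _ |>.trans
    (by simp)) fun x => Submodule.smul_mem _ _ (Submodule.mem_span_singleton_self y)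

theorem rankLE_of_rank_lt {f : E →L[𝕜] F} {n : ℕ}
    (h : LinearMap.rank (f : E →ₗ[𝕜] F) < (n : Cardinal)) : RankLE f n := by
  have h1 : Module.rank 𝕜 (LinearMap.range (f : E →ₗ[𝕜] F)) < (n : Cardinal) := h
  refine ⟨Module.rank_lt_aleph0_iff.1 (h1.trans Cardinal.natCast_lt_aleph0), ?_⟩
  exact finrank_le_of_rank_le h1.le

/-- The functionals factoring through a finite rank operator lie in a space of dimension at most
its rank. -/
theorem RankLE.exists_dual {f : E →L[𝕜] F} {n : ℕ} (h : RankLE f n) :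
    ∃ M : Submodule 𝕜 (StrongDual 𝕜 E), FiniteDimensional 𝕜 M ∧ finrank 𝕜 M ≤ n ∧
      ∀ φ : StrongDual 𝕜 F, φ ∘L f ∈ M := by
  have := h.1
  let R := LinearMap.range (f : E →ₗ[𝕜] F)
  let f' : E →L[𝕜] R := f.codRestrict _ fun x => ⟨x, rfl⟩
  let b := finBasis 𝕜 R
  let c : Fin (finrank 𝕜 R) → StrongDual 𝕜 E := fun i =>
    (LinearMap.toContinuousLinearMap (b.coord i)) ∘L f'
  refine ⟨Submodule.span 𝕜 (Set.range c), FiniteDimensional.span_of_finite 𝕜 (Set.finite_range c),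
    ?_, fun φ => ?_⟩
  · exact (finrank_range_le_card c).trans (by simpa using h.2)
  · have : φ ∘L f = ∑ i, φ (b i) • c i := by
      ext x
      have h1 : f x = ∑ i, b.repr (f' x) i • (b i : F) := by
        have := congrArg R.subtype (b.sum_repr (f' x))
        simp only [map_sum, map_smul] at this
        exact this.symm
      simp [h1, c, mul_comm]
    rw [this]
    exact Submodule.sum_mem _ fun i _ => Submodule.smul_mem _ _
      (Submodule.subset_span ⟨i, rfl⟩)

end Rank

/-! ### Preadjoints, and factorizations from local distance and property (D). -/

section Preadjoint

variable {X : Type v} {Y : Type w} [NormedAddCommGroup X] [NormedSpace 𝕜 X]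
  [NormedAddCommGroup Y] [NormedSpace 𝕜 Y]

/-- Restrict the adjoint of `R` to `X` inside its bidual and identify the bidual of `Y` with `Y`.
This carries operators built on the duals back to the spaces. -/
theorem IsReflexive.exists_preadjoint (hY : IsReflexive 𝕜 Y)
    (R : StrongDual 𝕜 Y →L[𝕜] StrongDual 𝕜 X) :
    ∃ r : X →L[𝕜] Y, (∀ φ x, φ (r x) = R φ x) ∧ ‖r‖ ≤ ‖R‖ := by
  let e := LinearIsometryEquiv.ofSurjective (NormedSpace.inclusionInDoubleDualLi (E := Y) 𝕜) hY
  let r : X →L[𝕜] Y := (e.symm : _ →L[𝕜] Y) ∘L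
    ((ContinuousLinearMap.compL 𝕜 (StrongDual 𝕜 Y) (StrongDual 𝕜 X) 𝕜).flip R ∘L
      NormedSpace.inclusionInDoubleDual 𝕜 X)
  have h1 : ∀ φ x, φ (r x) = R φ x := by
    intro φ x
    have h2 : e (r x) φ = R φ x := by
      simp [r]
    exact h2
  refine ⟨r, h1, ContinuousLinearMap.opNorm_le_bound _ (norm_nonneg R) fun x => ?_⟩
  refine NormedSpace.norm_le_dual_bound 𝕜 _ (by positivity) fun φ => ?_
  rw [h1]
  calc ‖R φ x‖ ≤ ‖R φ‖ * ‖x‖ := (R φ).le_opNorm x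
    _ ≤ ‖R‖ * ‖φ‖ * ‖x‖ := by gcongr; exact R.le_opNorm φ
    _ = _ := by ring

theorem exists_equiv_of_banachMazur_lt {c : ℝ} (hc : 0 ≤ c)
    (h : banachMazur 𝕜 X Y < ENNReal.ofReal c) :
    ∃ ψ : X ≃L[𝕜] Y, ‖(ψ : X →L[𝕜] Y)‖ * ‖(ψ.symm : Y →L[𝕜] X)‖ ≤ c := by
  obtain ⟨ψ, hψ⟩ := iInf_lt_iff.1 h
  exact ⟨ψ, (ENNReal.ofReal_le_ofReal_iff hc).1 hψ.le⟩

theorem exists_equiv_of_banachMazur_le {f : ℝ≥0} (h : banachMazur 𝕜 X Y ≤ (f : ℝ≥0∞)) :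
    ∃ ψ : X ≃L[𝕜] Y, ‖(ψ : X →L[𝕜] Y)‖ * ‖(ψ.symm : Y →L[𝕜] X)‖ ≤ f + 1 := by
  refine exists_equiv_of_banachMazur_lt (by positivity) (h.trans_lt ?_)
  rw [← ENNReal.ofReal_coe_nnreal]
  exact (ENNReal.ofReal_lt_ofReal_iff (by positivity)).2 (by simp)

theorem one_le_banachMazur [Nontrivial X] : 1 ≤ banachMazur 𝕜 X Y := by
  refine le_iInf fun ψ => ?_
  rw [ENNReal.one_le_ofReal]
  have h : ((ψ.symm : Y →L[𝕜] X) ∘L (ψ : X →L[𝕜] Y)) = ContinuousLinearMap.id 𝕜 X := by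
    ext x; simp
  calc (1 : ℝ) = ‖ContinuousLinearMap.id 𝕜 X‖ := by simp
    _ ≤ ‖(ψ.symm : Y →L[𝕜] X)‖ * ‖(ψ : X →L[𝕜] Y)‖ := by
      rw [← h]; exact ContinuousLinearMap.opNorm_comp_le _ _
    _ = _ := mul_comm _ _

theorem eq_of_forall_dual_comp_eq {f g : X →L[𝕜] Y} (h : ∀ (φ : StrongDual 𝕜 Y) x, φ (f x) = φ (g x)) :
    f = g := by
  ext x
  exact (SeparatingDual.eq_iff_forall_dual_eq (R := 𝕜)).2 fun φ => h φ x

/-- The projection onto `M`, with values in `M`. -/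
noncomputable def projCod {M : Submodule 𝕜 X} {P : X →L[𝕜] X} (hP : LinearMap.IsProj M P) : X →L[𝕜] M :=
  P.codRestrict M hP.map_mem

theorem norm_projCod_le {M : Submodule 𝕜 X} {P : X →L[𝕜] X} (hP : LinearMap.IsProj M P) :
    ‖projCod hP‖ ≤ ‖P‖ :=
  ContinuousLinearMap.opNorm_le_bound _ (norm_nonneg _) fun x => P.le_opNorm x

theorem projCod_coe {M : Submodule 𝕜 X} {P : X →L[𝕜] X} (hP : LinearMap.IsProj M P) (x : M) :
    projCod hP x = x := Subtype.ext (hP.map_id x x.2)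

theorem norm_subtypeL_comp_le {M : Submodule 𝕜 Y} (f : X →L[𝕜] M) : ‖M.subtypeL ∘L f‖ ≤ ‖f‖ :=
  ContinuousLinearMap.opNorm_le_bound _ (norm_nonneg _) fun x => f.le_opNorm x

/-- The local distance of the duals yields factorizations through `Y` of projections on `X`. -/
theorem LocalDistBound.exists_factorization (hX : IsReflexive 𝕜 X) (hY : IsReflexive 𝕜 Y)
    {K : ℕ → ℕ} {C : ℝ} {n : ℕ} {f : ℝ≥0} (hC : 0 ≤ C)
    (h : LocalDistBound 𝕜 K C (StrongDual 𝕜 X) (StrongDual 𝕜 Y) n f)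
    (M : Submodule 𝕜 (StrongDual 𝕜 X)) (M' : Submodule 𝕜 (StrongDual 𝕜 Y))
    (hM : FiniteDimensional 𝕜 M) (hM' : FiniteDimensional 𝕜 M')
    (hMn : finrank 𝕜 M ≤ n) (hMn' : finrank 𝕜 M' ≤ n) :
    ∃ (i : X →L[𝕜] Y) (j : Y →L[𝕜] X),
      (j ∘L i) ∘L (j ∘L i) = j ∘L i ∧ (j ∘L i) ∘L j = j ∧
      ‖j ∘L i‖ ≤ C ∧ ‖i ∘L j‖ ≤ C ∧ RankLE (j ∘L i) (K n) ∧
      (∀ φ ∈ M, φ ∘L (j ∘L i) = φ) ∧ (∀ φ ∈ M', φ ∘L (i ∘L j) = φ) ∧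
      ‖i‖ * ‖j‖ ≤ C ^ 2 * (f + 1) := by
  obtain ⟨N, N', hN, hN', ⟨P, hP, hPC⟩, ⟨Q, hQ, hQC⟩, hMN, hMN', -, hK, hd⟩ :=
    h M M' hM hM' hMn hMn'
  obtain ⟨ψ, hψ⟩ := exists_equiv_of_banachMazur_le hd
  let J : StrongDual 𝕜 X →L[𝕜] StrongDual 𝕜 Y :=
    N'.subtypeL ∘L ((ψ : N →L[𝕜] N') ∘L projCod hP)
  let I : StrongDual 𝕜 Y →L[𝕜] StrongDual 𝕜 X :=
    N.subtypeL ∘L ((ψ.symm : N' →L[𝕜] N) ∘L projCod hQ)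
  have hIJ : ∀ φ, I (J φ) = P φ := by
    intro φ
    simp only [I, J, ContinuousLinearMap.comp_apply, Submodule.subtypeL_apply, projCod_coe]
    simp [projCod]
  have hJI : ∀ φ, J (I φ) = Q φ := by
    intro φ
    simp only [I, J, ContinuousLinearMap.comp_apply, Submodule.subtypeL_apply, projCod_coe]
    simp [projCod]
  have hPP : ∀ φ, P (P φ) = P φ := fun φ => hP.map_id _ (hP.map_mem φ)
  have hJP : ∀ φ, J (P φ) = J φ := by
    intro φ
    have : projCod hP (P φ) = projCod hP φ := Subtype.ext (hPP φ)
    simp [J, this]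
  obtain ⟨i, hi, hin⟩ := hY.exists_preadjoint I
  obtain ⟨j, hj, hjn⟩ := hX.exists_preadjoint J
  have hp : ∀ φ x, φ (j (i x)) = P φ x := fun φ x => by rw [hj, hi, hIJ]
  have hq : ∀ φ x, φ (i (j x)) = Q φ x := fun φ x => by rw [hi, hj, hJI]
  have hpp : (j ∘L i) ∘L (j ∘L i) = j ∘L i :=
    eq_of_forall_dual_comp_eq fun φ x => by simp [hp, hPP]
  refine ⟨i, j, hpp, ?_, ?_, ?_, ?_, ?_, ?_, ?_⟩
  · exact eq_of_forall_dual_comp_eq fun φ y => by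
      simp only [ContinuousLinearMap.comp_apply, hp, hj, hJP]
  · refine ContinuousLinearMap.opNorm_le_bound _ hC fun x => ?_
    refine NormedSpace.norm_le_dual_bound 𝕜 _ (by positivity) fun φ => ?_
    rw [ContinuousLinearMap.comp_apply, hp]
    calc ‖P φ x‖ ≤ ‖P φ‖ * ‖x‖ := (P φ).le_opNorm x
      _ ≤ C * ‖φ‖ * ‖x‖ := by gcongr; exact P.le_of_opNorm_le hPC φ
      _ = _ := by ring
  · refine ContinuousLinearMap.opNorm_le_bound _ hC fun x => ?_
    refine NormedSpace.norm_le_dual_bound 𝕜 _ (by positivity) fun φ => ?_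
    rw [ContinuousLinearMap.comp_apply, hq]
    calc ‖Q φ x‖ ≤ ‖Q φ‖ * ‖x‖ := (Q φ).le_opNorm x
      _ ≤ C * ‖φ‖ * ‖x‖ := by gcongr; exact Q.le_of_opNorm_le hQC φ
      _ = _ := by ring
  -- The adjoint of `j ∘ i` is `P`, so functionals in `N` separate the points of its range; this
  -- embeds the range in the dual of `N`.
  · let R := LinearMap.range ((j ∘L i : X →L[𝕜] X) : X →ₗ[𝕜] X)
    let Φ : R →ₗ[𝕜] Dual 𝕜 N :=
      { toFun := fun x => { toFun := fun φ => (φ : StrongDual 𝕜 X) x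
                            map_add' := fun a b => by simp
                            map_smul' := fun a b => by simp }
        map_add' := fun a b => by ext; simp
        map_smul' := fun a b => by ext; simp }
    have hΦ : Function.Injective Φ := by
      rw [← LinearMap.ker_eq_bot, LinearMap.ker_eq_bot']
      rintro ⟨_, x, rfl⟩ hx
      apply Subtype.ext
      refine (SeparatingDual.eq_iff_forall_dual_eq (R := 𝕜)).2 fun φ => ?_
      have h1 := LinearMap.congr_fun hx ⟨P φ, hP.map_mem φ⟩
      change P φ (j (i x)) = 0 at h1
      change φ (j (i x)) = φ 0
      rw [hp, hPP] at h1
      rw [hp, h1, map_zero]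
    have : FiniteDimensional 𝕜 R := FiniteDimensional.of_injective Φ hΦ
    refine ⟨this, (LinearMap.finrank_le_finrank_of_injective hΦ).trans ?_⟩
    rw [Subspace.dual_finrank_eq]
    exact hK
  · intro φ hφ
    ext x
    rw [ContinuousLinearMap.comp_apply, ContinuousLinearMap.comp_apply, hp,
      hP.map_id φ (hMN hφ)]
  · intro φ hφ
    ext x
    rw [ContinuousLinearMap.comp_apply, ContinuousLinearMap.comp_apply, hq,
      hQ.map_id φ (hMN' hφ)]
  · have h1 : ‖I‖ ≤ ‖(ψ.symm : N' →L[𝕜] N)‖ * C :=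
      (norm_subtypeL_comp_le _).trans ((ContinuousLinearMap.opNorm_comp_le _ _).trans
        (by gcongr; exact (norm_projCod_le hQ).trans hQC))
    have h2 : ‖J‖ ≤ ‖(ψ : N →L[𝕜] N')‖ * C :=
      (norm_subtypeL_comp_le _).trans ((ContinuousLinearMap.opNorm_comp_le _ _).trans
        (by gcongr; exact (norm_projCod_le hP).trans hPC))
    calc ‖i‖ * ‖j‖ ≤ (‖(ψ.symm : N' →L[𝕜] N)‖ * C) * (‖(ψ : N →L[𝕜] N')‖ * C) := by
          gcongr
          exacts [hin.trans h1, hjn.trans h2]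
      _ = C ^ 2 * (‖(ψ : N →L[𝕜] N')‖ * ‖(ψ.symm : N' →L[𝕜] N)‖) := by ring
      _ ≤ _ := by gcongr

/-- Property (D) for a finite rank idempotent: an orthogonal copy of it. -/
theorem PropertyD.exists_orthogonal_copy {f : ℕ → ℝ≥0} {d D : ℝ} (hD : PropertyD 𝕜 Y f d D)
    {q : Y →L[𝕜] Y} (hq : q ∘L q = q) {r : ℕ} (hr : RankLE q r) {c : ℝ} (hc : 0 ≤ c)
    (hqc : ‖q‖ ≤ c) :
    ∃ Q u v : Y →L[𝕜] Y, Q ∘L Q = Q ∧ RankLE Q r ∧ ‖Q‖ ≤ D * c ^ d ∧ q ∘L Q = 0 ∧ Q ∘L q = 0 ∧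
      v ∘L u = q ∧ Q ∘L u = u ∧ v ∘L Q = v ∧ ‖u‖ * ‖v‖ ≤ (f r + 1) * c * (D * c ^ d) := by
  have hD0 := hD.D_pos
  have hcd : 0 ≤ D * c ^ d := mul_nonneg hD0.le (Real.rpow_nonneg hc d)
  have := hr.1
  let M := LinearMap.range (q : Y →ₗ[𝕜] Y)
  -- Property (D) speaks of positive dimensions only, so the zero idempotent is treated apart.
  rcases Nat.eq_zero_or_pos (finrank 𝕜 M) with h0 | h0
  · have hM : M = ⊥ := Submodule.finrank_eq_zero.1 h0
    have hq0 : q = 0 := by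
      ext y
      have : q y ∈ M := ⟨y, rfl⟩
      rw [hM] at this
      simpa using this
    refine ⟨0, 0, 0, by simp, rankLE_zero _, by simpa using hcd, by simp, by simp, by simp [hq0],
      by simp, by simp, ?_⟩
    simp only [norm_zero, mul_zero]
    positivity
  have hqM : LinearMap.IsProj M q := by
    refine ⟨fun x => ⟨x, rfl⟩, ?_⟩
    rintro _ ⟨x, rfl⟩
    exact DFunLike.congr_fun hq x
  obtain ⟨N, Q, hN, hNr, hQN, -, hQ, h1, h2, hd⟩ := hD.exists_copy _ h0 c M q hr.1 rfl hqM hqc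
  obtain ⟨ψ, hψ⟩ := exists_equiv_of_banachMazur_le hd
  have hQQ : Q ∘L Q = Q := by
    ext y
    exact hQN.map_id _ (hQN.map_mem y)
  let u : Y →L[𝕜] Y := N.subtypeL ∘L ((ψ : M →L[𝕜] N) ∘L projCod hqM)
  let v : Y →L[𝕜] Y := M.subtypeL ∘L ((ψ.symm : N →L[𝕜] M) ∘L projCod hQN)
  refine ⟨Q, u, v, hQQ, .of_range_le (hNr.le.trans hr.2) hQN.map_mem, hQ, h1, h2, ?_, ?_, ?_, ?_⟩
  · ext y
    simp only [u, v, ContinuousLinearMap.comp_apply, Submodule.subtypeL_apply, projCod_coe]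
    simp [projCod]
  · ext y
    exact hQN.map_id _ (Subtype.prop _)
  · ext y
    have : projCod hQN (Q y) = projCod hQN y := Subtype.ext (DFunLike.congr_fun hQQ y)
    simp [v, this]
  · have h3 : ‖u‖ ≤ ‖(ψ : M →L[𝕜] N)‖ * c :=
      (norm_subtypeL_comp_le _).trans ((ContinuousLinearMap.opNorm_comp_le _ _).trans
        (by gcongr; exact (norm_projCod_le hqM).trans hqc))
    have h4 : ‖v‖ ≤ ‖(ψ.symm : N →L[𝕜] M)‖ * (D * c ^ d) :=
      (norm_subtypeL_comp_le _).trans ((ContinuousLinearMap.opNorm_comp_le _ _).trans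
        (by gcongr; exact (norm_projCod_le hQN).trans hQ))
    have hf : (f (finrank 𝕜 M) : ℝ) ≤ f r :=
      hD.mono h0 (le_trans h0 hr.2 : 1 ≤ r) hr.2
    calc ‖u‖ * ‖v‖ ≤ (‖(ψ : M →L[𝕜] N)‖ * c) * (‖(ψ.symm : N →L[𝕜] M)‖ * (D * c ^ d)) := by
          gcongr
      _ = (‖(ψ : M →L[𝕜] N)‖ * ‖(ψ.symm : N →L[𝕜] M)‖) * c * (D * c ^ d) := by ring
      _ ≤ _ := by
        gcongr
        exact hψ.trans (by gcongr)

end Preadjoint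


/-! ### Dense range of the first factor, by Baire category. -/

section DenseRange

variable {X : Type v} {Y : Type w} [NormedAddCommGroup X] [NormedSpace 𝕜 X]
  [NormedAddCommGroup Y] [NormedSpace 𝕜 Y]

/-- A compact operator is arbitrarily close to zero at the difference of two of the members of a
bounded sequence. -/
theorem exists_ne_norm_sub_lt {S : Y →L[𝕜] X} (hS : IsCompactOperator S) {g : ℕ → Y} {R : ℝ}
    (hg : ∀ n, ‖g n‖ ≤ R) {ε : ℝ} (hε : 0 < ε) :
    ∃ m n, m ≠ n ∧ ‖S (g m - g n)‖ < ε := by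
  obtain ⟨K, hK, hSK⟩ := hS.image_closedBall_subset_compact (f := (S : Y →ₗ[𝕜] X)) R
  obtain ⟨a, -, φ, hφ, ha⟩ := hK.tendsto_subseq (x := fun n => S (g n))
    fun n => hSK ⟨g n, by simpa using hg n, rfl⟩
  obtain ⟨N, hN⟩ := Metric.cauchySeq_iff.1 ha.cauchySeq ε hε
  refine ⟨φ N, φ (N + 1), hφ.injective.ne (by simp), ?_⟩
  have := hN N le_rfl (N + 1) (by simp)
  rw [map_sub]
  simpa [dist_eq_norm] using this

/-- A compact operator on an infinite dimensional space is not bounded below. -/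
theorem exists_norm_one_apply_lt {S : Y →L[𝕜] X} (hS : IsCompactOperator S)
    (hY : ¬ FiniteDimensional 𝕜 Y) {ε : ℝ} (hε : 0 < ε) : ∃ y : Y, ‖y‖ = 1 ∧ ‖S y‖ < ε := by
  obtain ⟨R, g, -, hg, hg'⟩ := exists_seq_norm_le_one_le_norm_sub (𝕜 := 𝕜) hY
  obtain ⟨m, n, hmn, h⟩ := exists_ne_norm_sub_lt hS hg hε
  have h1 : 1 ≤ ‖g m - g n‖ := hg' hmn
  have h0 : ‖g m - g n‖ ≠ 0 := by positivity
  refine ⟨((‖g m - g n‖⁻¹ : ℝ) : 𝕜) • (g m - g n), ?_, ?_⟩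
  · rw [norm_smul]
    simp [h0]
  · rw [map_smul, norm_smul]
    simp only [RCLike.norm_ofReal, abs_inv, abs_norm]
    calc ‖g m - g n‖⁻¹ * ‖S (g m - g n)‖ ≤ 1 * ‖S (g m - g n)‖ := by
          gcongr; exact inv_le_one_of_one_le₀ h1
      _ < ε := by simpa using h

/-- If `A` has infinite dimensional range, there are a functional nearly annihilating the range of
`A` and a bounded vector of that range on which it is large while `S` is small there. -/
theorem exists_functional_of_infinite_range {A : X →L[𝕜] Y} {S : Y →L[𝕜] X}
    (hA : IsCompactOperator A) (hS : IsCompactOperator S)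
    (hinf : ¬ FiniteDimensional 𝕜 (LinearMap.range (A : X →ₗ[𝕜] Y))) :
    ∃ R : ℝ, 0 < R ∧ ∀ ε₁ > 0, ∀ ε₂ > 0, ∃ (e : X) (h : StrongDual 𝕜 Y),
      ‖A e‖ ≤ R ∧ ‖S (A e)‖ ≤ ε₁ ∧ ‖h‖ ≤ 1 ∧ 1 ≤ ‖h (A e)‖ ∧ ‖h ∘L A‖ ≤ ε₂ := by
  obtain ⟨c, hc⟩ := NormedField.exists_one_lt_norm 𝕜
  have hRpos : 0 < ‖c‖ + 2 := by positivity
  refine ⟨2 * (‖c‖ + 2), by positivity, fun ε₁ h₁ ε₂ h₂ => ?_⟩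
  have htb : TotallyBounded ((A : X →ₗ[𝕜] Y) '' Metric.closedBall 0 1) :=
    (hA.isCompact_closure_image_closedBall (f := (A : X →ₗ[𝕜] Y)) 1).totallyBounded.subset
      subset_closure
  obtain ⟨t, htsub, htfin, htcov⟩ := Metric.finite_approx_of_totallyBounded htb ε₂ h₂
  -- `F` is spanned by a finite `ε₂`-net of the image of the unit ball, so a functional of norm at
  -- most 1 vanishing on `F` has size at most `ε₂` after composition with `A`. It is found by
  -- Hahn–Banach in `Y ⧸ F`, where the image of the range of `A` is still infinite dimensional.
  let F : Submodule 𝕜 Y := Submodule.span 𝕜 t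
  have hFfin : FiniteDimensional 𝕜 F := FiniteDimensional.span_of_finite 𝕜 htfin
  have hFA : F ≤ LinearMap.range (A : X →ₗ[𝕜] Y) := by
    refine Submodule.span_le.2 fun y hy => ?_
    obtain ⟨x, -, rfl⟩ := htsub hy
    exact ⟨x, rfl⟩
  have hFc : IsClosed (F : Set Y) := F.closed_of_finiteDimensional
  have : IsClosed (F : Set Y) := hFc
  let G : Submodule 𝕜 (Y ⧸ F) := (LinearMap.range (A : X →ₗ[𝕜] Y)).map F.mkQ
  have hG : ¬ FiniteDimensional 𝕜 G := by
    intro hG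
    apply hinf
    have hfg : G.FG := Module.Finite.iff_fg.1 hG
    have hfg2 : (LinearMap.range (A : X →ₗ[𝕜] Y) ⊓ LinearMap.ker F.mkQ).FG := by
      rw [Submodule.ker_mkQ, inf_eq_right.2 hFA]
      exact Module.Finite.iff_fg.1 hFfin
    exact Module.Finite.iff_fg.2 (Submodule.fg_of_fg_map_of_fg_inf_ker F.mkQ hfg hfg2)
  obtain ⟨w, hw, hw'⟩ := exists_seq_norm_le_one_le_norm_sub' hc (R := ‖c‖ + 1) (by linarith) hG
  have hlift : ∀ n, ∃ x : X, ‖A x‖ ≤ ‖c‖ + 2 ∧ F.mkQ (A x) = w n := by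
    intro n
    obtain ⟨_, ⟨x, rfl⟩, hx⟩ := (w n).2
    obtain ⟨y, hy, hyn⟩ := Submodule.Quotient.norm_mk_lt (S := F) (w n : Y ⧸ F) one_pos
    -- A lift of nearly minimal norm stays in the range of `A` because `F` lies in it.
    have hyr : y ∈ LinearMap.range (A : X →ₗ[𝕜] Y) := by
      have h3 : y - A x ∈ F := by
        rw [← Submodule.Quotient.eq]
        exact hy.trans hx.symm
      have := Submodule.add_mem _ (hFA h3) ⟨x, rfl⟩
      simpa using this
    obtain ⟨x', rfl⟩ := hyr
    refine ⟨x', ?_, hy⟩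
    have h4 : ‖(w n : Y ⧸ F)‖ ≤ ‖c‖ + 1 := hw n
    have h5 : ‖A x'‖ < ‖(w n : Y ⧸ F)‖ + 1 := hyn
    linarith
  choose x hx hxw using hlift
  obtain ⟨m, n, hmn, hmn'⟩ := exists_ne_norm_sub_lt hS hx h₁
  have hsep : 1 ≤ ‖F.mkQ (A (x m) - A (x n))‖ := by
    rw [map_sub, hxw, hxw]
    exact hw' hmn
  obtain ⟨h₀, hh₀, hh₀'⟩ := exists_dual_vector'' 𝕜 (F.mkQ (A (x m) - A (x n)))
  let h : StrongDual 𝕜 Y := LinearMap.mkContinuous (h₀.toLinearMap ∘ₗ F.mkQ) 1 (fun y => by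
    calc ‖h₀ (F.mkQ y)‖ ≤ 1 * ‖F.mkQ y‖ := h₀.le_of_opNorm_le hh₀ _
      _ ≤ 1 * ‖y‖ := by gcongr; exact Submodule.Quotient.norm_mk_le F y)
  have hh1 : ‖h‖ ≤ 1 := LinearMap.mkContinuous_norm_le _ zero_le_one _
  have hhF : ∀ y ∈ F, h y = 0 := by
    intro y hy
    change h₀ (F.mkQ y) = 0
    rw [show F.mkQ y = 0 by simpa using hy, map_zero]
  refine ⟨x m - x n, h, ?_, ?_, hh1, ?_, ?_⟩
  · rw [map_sub]
    refine (norm_sub_le _ _).trans ?_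
    linarith [hx m, hx n]
  · rw [map_sub]
    exact hmn'.le
  · rw [map_sub]
    change 1 ≤ ‖h₀ (F.mkQ (A (x m) - A (x n)))‖
    rw [hh₀']
    simpa using hsep
  · refine ContinuousLinearMap.opNorm_le_of_unit_norm h₂.le fun z hz => ?_
    obtain ⟨y, hy, hyz⟩ : ∃ y ∈ t, dist (A z) y < ε₂ := by
      have := htcov ⟨z, by simp [hz], rfl⟩
      simpa using this
    have h6 : h (A z) = h (A z - y) := by
      rw [map_sub, hhF y (Submodule.subset_span hy), sub_zero]
    rw [ContinuousLinearMap.comp_apply, h6]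
    calc ‖h (A z - y)‖ ≤ 1 * ‖A z - y‖ := h.le_of_opNorm_le hh1 _
      _ ≤ ε₂ := by rw [one_mul, ← dist_eq_norm]; exact hyz.le

/-- The factorizations `T = S ∘ A` through `Y` into compact operators with
`S Y ⊆ closure (T X)`. -/
structure IsFactorization (T : X →L[𝕜] X) (A : X →L[𝕜] Y) (S : Y →L[𝕜] X) : Prop where
  compact_left : IsCompactOperator A
  compact_right : IsCompactOperator S
  comp_eq : S ∘L A = T
  mem_closure : ∀ y, S y ∈ closure (Set.range T)

theorem IsFactorization.add_smulRight_of_apply_eq_zero {T : X →L[𝕜] X} {A : X →L[𝕜] Y}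
    {S : Y →L[𝕜] X} (h : IsFactorization T A S) (φ : StrongDual 𝕜 X) {g : Y} (hg : S g = 0) :
    IsFactorization T (A + φ.smulRight g) S where
  compact_left := h.compact_left.add (isCompactOperator_smulRight φ g)
  compact_right := h.compact_right
  comp_eq := by
    ext x
    simp [hg, ← h.comp_eq]
  mem_closure := h.mem_closure

/-- With `V = 1 + φ ⊗ g`, the new pair is `V A` and `S V⁻¹`; the scalar `c` is the one occurring in
the inverse of a rank-one perturbation of the identity. -/
theorem IsFactorization.conj {T : X →L[𝕜] X} {A : X →L[𝕜] Y}
    {S : Y →L[𝕜] X} (h : IsFactorization T A S) (φ : StrongDual 𝕜 Y) (g : Y) {c : 𝕜}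
    (hc : c * (1 + φ g) = 1) :
    IsFactorization T (A + (φ ∘L A).smulRight g) (S - φ.smulRight (c • S g)) where
  compact_left := h.compact_left.add (isCompactOperator_smulRight _ g)
  compact_right := h.compact_right.sub (isCompactOperator_smulRight _ _)
  comp_eq := by
    ext x
    have h1 : S (A x) = T x := by rw [← h.comp_eq]; rfl
    simp only [ContinuousLinearMap.comp_apply, sub_apply,
      add_apply, ContinuousLinearMap.smulRight_apply, map_add, map_smul, h1,
      smul_smul]
    have h2 : T x - (φ (A x) * c) • S g + φ (A x) • (S g - (φ g * c) • S g) =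
        T x + (φ (A x) * (1 - c * (1 + φ g))) • S g := by module
    rw [h2, hc]
    simp
  mem_closure y := by
    have h1 : (S - φ.smulRight (c • S g)) y = S (y - (φ y * c) • g) := by
      simp [smul_smul]
    rw [h1]
    exact h.mem_closure _

/-- Here `T X` is finite dimensional, hence closed, so `S y = T x₀` for some `x₀` and `g = y - A x₀`
lies in the kernel of `S`. Adding `φ ⊗ g` to `A` leaves the product unchanged. A small `φ` can still
reach the value 1 by moving far along a direction `e` that `A` almost kills. -/
theorem IsFactorization.exists_near_finite {T : X →L[𝕜] X} {A : X →L[𝕜] Y} {S : Y →L[𝕜] X}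
    (h : IsFactorization T A S) (hX : ¬ FiniteDimensional 𝕜 X)
    (hfin : FiniteDimensional 𝕜 (LinearMap.range (A : X →ₗ[𝕜] Y))) (y : Y) {ε : ℝ} (hε : 0 < ε) :
    ∃ A' S', IsFactorization T A' S' ∧ ‖A' - A‖ < ε ∧ ‖S' - S‖ < ε ∧ ∃ x, ‖A' x - y‖ < ε := by
  have hTr : IsClosed (Set.range T) := by
    have h1 : LinearMap.range (T : X →ₗ[𝕜] X) =
        (LinearMap.range (A : X →ₗ[𝕜] Y)).map (S : Y →ₗ[𝕜] X) := by
      rw [← LinearMap.range_comp, ← h.comp_eq]; rfl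
    have : FiniteDimensional 𝕜 (LinearMap.range (T : X →ₗ[𝕜] X)) := by
      rw [h1]; infer_instance
    exact (LinearMap.range (T : X →ₗ[𝕜] X)).closed_of_finiteDimensional
  obtain ⟨x₀, hx₀⟩ : S y ∈ Set.range T := hTr.closure_eq ▸ h.mem_closure y
  let g := y - A x₀
  have hg : S g = 0 := by
    simp only [g, map_sub, ← hx₀, ← h.comp_eq, ContinuousLinearMap.comp_apply, sub_self]
  obtain ⟨δ, hδ, hδg⟩ : ∃ δ : ℝ, 0 < δ ∧ δ * ‖g‖ < ε :=
    ⟨ε / (‖g‖ + 1), by positivity, by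
      rw [div_mul_eq_mul_div, div_lt_iff₀ (by positivity)]; nlinarith [norm_nonneg g]⟩
  obtain ⟨e, he, hAe⟩ := exists_norm_one_apply_lt h.compact_left hX
    (ε := ε / ((1 + δ * ‖x₀‖) / δ)) (by positivity)
  obtain ⟨φ₀, hφ₀, hφ₀e⟩ := exists_dual_vector'' 𝕜 e
  let φ : StrongDual 𝕜 X := (δ : 𝕜) • φ₀
  have hφ : ‖φ‖ ≤ δ := by
    rw [norm_smul, RCLike.norm_ofReal, abs_of_pos hδ]
    nlinarith
  have hδ' : (δ : 𝕜) ≠ 0 := by exact_mod_cast hδ.ne'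
  have hφe : φ e = δ := by simp [φ, hφ₀e, he]
  -- Chosen so that `φ (x₀ + r • e) = 1`. The bound on `r` depends only on `δ` and `x₀`, which were
  -- fixed before `e`.
  let r : 𝕜 := (1 - φ x₀) / δ
  have hr : ‖r‖ ≤ (1 + δ * ‖x₀‖) / δ := by
    rw [norm_div, RCLike.norm_ofReal, abs_of_pos hδ]
    gcongr
    refine (norm_sub_le _ _).trans ?_
    rw [norm_one]
    gcongr
    exact φ.le_of_opNorm_le hφ x₀
  refine ⟨A + φ.smulRight g, S, h.add_smulRight_of_apply_eq_zero φ hg, ?_, by simpa using hε,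
    x₀ + r • e, ?_⟩
  · rw [add_sub_cancel_left, ContinuousLinearMap.norm_smulRight_apply]
    exact lt_of_le_of_lt (by gcongr) hδg
  · have h1 : φ (x₀ + r • e) = 1 := by
      simp only [map_add, map_smul, hφe, r, smul_eq_mul]
      field_simp
      ring
    have h2 : (A + φ.smulRight g) (x₀ + r • e) - y = r • A e := by
      rw [add_apply, ContinuousLinearMap.smulRight_apply, h1]
      simp only [one_smul, map_add, map_smul, g]
      abel
    rw [h2, norm_smul]
    have h3 : 0 < (1 + δ * ‖x₀‖) / δ := by positivity
    calc ‖r‖ * ‖A e‖ ≤ (1 + δ * ‖x₀‖) / δ * ‖A e‖ := by gcongr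
      _ < (1 + δ * ‖x₀‖) / δ * (ε / ((1 + δ * ‖x₀‖) / δ)) := by gcongr
      _ = ε := by field_simp

/-- Conjugate by `1 + φ ⊗ g`, with `g` chosen so that `x₀ + e` is sent to `y₁`, a point near `y`.
The change in `A` is small because `φ ∘ A` is; the change in `S` is small because `S y ≈ T x₀` and
`S (A e) ≈ 0`. The order of choices matters: `B` depends on `x₀` but only on the uniform bound `R`
for `A e`, so `ε₂` can be fixed before `e` and `φ`. -/
theorem IsFactorization.exists_near_infinite {T : X →L[𝕜] X} {A : X →L[𝕜] Y} {S : Y →L[𝕜] X}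
    (h : IsFactorization T A S)
    (hinf : ¬ FiniteDimensional 𝕜 (LinearMap.range (A : X →ₗ[𝕜] Y))) (y : Y) {ε : ℝ}
    (hε : 0 < ε) :
    ∃ A' S', IsFactorization T A' S' ∧ ‖A' - A‖ < ε ∧ ‖S' - S‖ < ε ∧ ∃ x, ‖A' x - y‖ < ε := by
  obtain ⟨R, hR, hex⟩ := exists_functional_of_infinite_range h.compact_left h.compact_right hinf
  obtain ⟨τ, hτ, hτR⟩ : ∃ τ : ℝ, 0 < τ ∧ τ * R < ε :=
    ⟨ε / (2 * R), by positivity, by field_simp; linarith⟩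
  obtain ⟨ε₁, h₁, hε₁⟩ : ∃ ε₁ : ℝ, 0 < ε₁ ∧ (2 + τ) * ε₁ / (τ / 2) < ε := by
    refine ⟨ε * (τ / 2) / (2 + τ) / 2, by positivity, ?_⟩
    field_simp
    linarith
  obtain ⟨x₀, hx₀⟩ : ∃ x₀, ‖S y - T x₀‖ < ε₁ := by
    obtain ⟨_, ⟨x₀, rfl⟩, hx⟩ := Metric.mem_closure_iff.1 (h.mem_closure y) ε₁ h₁
    exact ⟨x₀, by rwa [← dist_eq_norm]⟩
  let B := ‖y‖ + ‖A x₀‖ + (1 + τ) * R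
  have hB : 0 < B := by positivity
  obtain ⟨ε₂, h₂, hε₂x, hε₂⟩ : ∃ ε₂ : ℝ, 0 < ε₂ ∧ ε₂ * ‖x₀‖ ≤ 1 / 2 ∧ ε₂ * (2 * B) < ε := by
    refine ⟨min (1 / (2 * (‖x₀‖ + 1))) (ε / (4 * B)), by positivity, ?_, ?_⟩
    · calc _ ≤ 1 / (2 * (‖x₀‖ + 1)) * ‖x₀‖ := by gcongr; exact min_le_left _ _
        _ ≤ 1 / 2 := by
          rw [div_mul_eq_mul_div, div_le_div_iff₀ (by positivity) (by positivity)]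
          nlinarith [norm_nonneg x₀]
    · calc _ ≤ ε / (4 * B) * (2 * B) := by gcongr; exact min_le_right _ _
        _ < ε := by field_simp; linarith
  obtain ⟨e, φ, heR, hSe, hφ, hφe, hφA⟩ := hex ε₁ h₁ ε₂ h₂
  let z := A (x₀ + e)
  let θ := φ z
  have hθ : 1 / 2 ≤ ‖θ‖ := by
    have h3 : ‖φ (A x₀)‖ ≤ 1 / 2 := ((φ ∘L A).le_of_opNorm_le hφA x₀).trans hε₂x
    have h4 : φ (A e) = θ - φ (A x₀) := by simp [θ, z]
    have h5 := norm_sub_le θ (φ (A x₀))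
    rw [← h4] at h5
    linarith
  have hθ0 : θ ≠ 0 := by
    rw [← norm_pos_iff]; linarith
  -- The inverse of the perturbation involves `1 / φ y₁`; shifting `y` slightly along `A e`, when
  -- necessary, keeps `φ y₁` away from zero.
  obtain ⟨σ, hσ0, hσ, hσφ⟩ : ∃ σ : ℝ, 0 ≤ σ ∧ σ ≤ τ ∧ τ / 2 ≤ ‖φ (y + (σ : 𝕜) • A e)‖ := by
    by_cases hy : τ / 2 ≤ ‖φ y‖
    · exact ⟨0, le_rfl, hτ.le, by simpa using hy⟩
    · refine ⟨τ, hτ.le, le_rfl, ?_⟩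
      push Not at hy
      have h3 : (τ : 𝕜) • φ (A e) = φ (y + (τ : 𝕜) • A e) - φ y := by simp
      have h4 := norm_sub_le (φ (y + (τ : 𝕜) • A e)) (φ y)
      rw [← h3, norm_smul, RCLike.norm_ofReal, abs_of_pos hτ] at h4
      nlinarith
  let y₁ := y + (σ : 𝕜) • A e
  have hσn : ‖(σ : 𝕜)‖ ≤ τ := by
    rw [RCLike.norm_ofReal, abs_of_nonneg hσ0]; exact hσ
  have hφy₁ : φ y₁ ≠ 0 := by
    rw [← norm_pos_iff]; exact lt_of_lt_of_le (by positivity) hσφ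
  let g := θ⁻¹ • (y₁ - z)
  have hφg : 1 + φ g = φ y₁ / θ := by
    simp only [g, map_smul, map_sub, smul_eq_mul]
    change 1 + θ⁻¹ * (φ y₁ - θ) = _
    field_simp
    ring
  have hc : (θ / φ y₁) * (1 + φ g) = 1 := by
    rw [hφg]; field_simp
  refine ⟨_, _, h.conj φ g hc, ?_, ?_, x₀ + e, ?_⟩
  · rw [add_sub_cancel_left, ContinuousLinearMap.norm_smulRight_apply]
    have h3 : ‖y₁ - z‖ ≤ B := by
      have : y₁ - z = y + (σ : 𝕜) • A e - A x₀ - A e := by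
        simp only [y₁, z, map_add]; abel
      rw [this]
      calc _ ≤ ‖y‖ + ‖(σ : 𝕜) • A e‖ + ‖A x₀‖ + ‖A e‖ :=
            norm_sub_le_of_le (norm_sub_le_of_le (norm_add_le _ _) le_rfl) le_rfl
        _ ≤ ‖y‖ + τ * R + ‖A x₀‖ + R := by rw [norm_smul]; gcongr
        _ = B := by simp only [B]; ring
    have h4 : ‖g‖ ≤ 2 * B := by
      rw [norm_smul, norm_inv]
      gcongr
      rw [inv_le_comm₀ (by linarith) (by norm_num)]
      linarith
    exact lt_of_le_of_lt (by gcongr) hε₂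
  · rw [sub_sub_cancel_left, norm_neg, ContinuousLinearMap.norm_smulRight_apply]
    have h3 : (θ / φ y₁) • S g = (φ y₁)⁻¹ • S (y₁ - z) := by
      simp only [g, map_smul, smul_smul]
      congr 1
      field_simp
    have h4 : ‖S (y₁ - z)‖ ≤ (2 + τ) * ε₁ := by
      have : S (y₁ - z) = (S y - T x₀) + (σ : 𝕜) • S (A e) - S (A e) := by
        simp only [y₁, z, map_add, map_sub, map_smul, ← h.comp_eq,
          ContinuousLinearMap.comp_apply]
        abel
      rw [this]
      calc _ ≤ ‖S y - T x₀‖ + ‖(σ : 𝕜) • S (A e)‖ + ‖S (A e)‖ :=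
            norm_sub_le_of_le (norm_add_le _ _) le_rfl
        _ ≤ ε₁ + τ * ε₁ + ε₁ := by rw [norm_smul]; gcongr
        _ = _ := by ring
    rw [h3, norm_smul, norm_inv]
    refine lt_of_le_of_lt ?_ hε₁
    calc ‖φ‖ * (‖φ y₁‖⁻¹ * ‖S (y₁ - z)‖) ≤ 1 * ((τ / 2)⁻¹ * ((2 + τ) * ε₁)) := by gcongr
      _ = _ := by rw [one_mul, inv_mul_eq_div]
  · have h3 : (A + (φ ∘L A).smulRight g) (x₀ + e) - y = (σ : 𝕜) • A e := by
      simp only [add_apply, ContinuousLinearMap.smulRight_apply,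
        ContinuousLinearMap.comp_apply]
      change z + θ • θ⁻¹ • (y₁ - z) - y = _
      rw [smul_smul, mul_inv_cancel₀ hθ0, one_smul]
      simp [y₁]
    rw [h3, norm_smul]
    exact lt_of_le_of_lt (by gcongr) hτR

theorem isClosed_setOf_isFactorization [CompleteSpace X] [CompleteSpace Y] (T : X →L[𝕜] X) :
    IsClosed {p : (X →L[𝕜] Y) × (Y →L[𝕜] X) | IsFactorization T p.1 p.2} := by
  have h1 : IsClosed {p : (X →L[𝕜] Y) × (Y →L[𝕜] X) | IsCompactOperator p.1} :=
    (isClosed_setOfPred_isCompactOperator (σ₁₂ := RingHom.id 𝕜) (M₁ := X) (M₂ := Y)).preimage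
      continuous_fst
  have h2 : IsClosed {p : (X →L[𝕜] Y) × (Y →L[𝕜] X) | IsCompactOperator p.2} :=
    (isClosed_setOfPred_isCompactOperator (σ₁₂ := RingHom.id 𝕜) (M₁ := Y) (M₂ := X)).preimage
      continuous_snd
  have h3 : IsClosed {p : (X →L[𝕜] Y) × (Y →L[𝕜] X) | p.2 ∘L p.1 = T} :=
    isClosed_eq (by fun_prop) continuous_const
  have h4 : IsClosed {p : (X →L[𝕜] Y) × (Y →L[𝕜] X) | ∀ y, p.2 y ∈ closure (Set.range T)} := by
    simp only [Set.ofPred_forall]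
    exact isClosed_iInter fun y => isClosed_closure.preimage (by fun_prop)
  have : {p : (X →L[𝕜] Y) × (Y →L[𝕜] X) | IsFactorization T p.1 p.2} =
      {p | IsCompactOperator p.1} ∩ {p | IsCompactOperator p.2} ∩ {p | p.2 ∘L p.1 = T} ∩
        {p | ∀ y, p.2 y ∈ closure (Set.range T)} := by
    ext p
    exact ⟨fun h => ⟨⟨⟨h.1, h.2⟩, h.3⟩, h.4⟩, fun h => ⟨h.1.1.1, h.1.1.2, h.1.2, h.2⟩⟩
  rw [this]
  exact ((h1.inter h2).inter h3).inter h4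

/-- If `T` factors, then it factors with a first factor of dense range. -/
theorem IsFactorization.exists_denseRange [CompleteSpace X] [CompleteSpace Y]
    [TopologicalSpace.SeparableSpace Y] {T : X →L[𝕜] X} {A : X →L[𝕜] Y} {S : Y →L[𝕜] X}
    (h : IsFactorization T A S) (hX : ¬ FiniteDimensional 𝕜 X) :
    ∃ (A' : X →L[𝕜] Y) (S' : Y →L[𝕜] X), IsFactorization T A' S' ∧ DenseRange A' := by
  let Z := {p : (X →L[𝕜] Y) × (Y →L[𝕜] X) // IsFactorization T p.1 p.2}
  have : CompleteSpace Z := (isClosed_setOf_isFactorization T).completeSpace_coe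
  have : Nonempty Z := ⟨⟨(A, S), h⟩⟩
  obtain ⟨D, hDc, hD⟩ := TopologicalSpace.exists_countable_dense Y
  have := hDc.to_subtype
  let U : D × ℕ → Set Z := fun i => {p | ∃ x, ‖p.1.1 x - (i.1 : Y)‖ < 1 / ((i.2 : ℝ) + 1)}
  have hUo : ∀ i, IsOpen (U i) := by
    intro i
    simp only [U, Set.ofPred_exists]
    refine isOpen_iUnion fun x => isOpen_lt ?_ continuous_const
    fun_prop
  have hUd : ∀ i, Dense (U i) := by
    intro i
    refine Metric.dense_iff.2 fun p r hr => ?_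
    have hε : 0 < min r (1 / ((i.2 : ℝ) + 1)) := by positivity
    obtain ⟨A', S', hf, hA', hS', x, hx⟩ : ∃ A' S', IsFactorization T A' S' ∧
        ‖A' - p.1.1‖ < min r (1 / ((i.2 : ℝ) + 1)) ∧ ‖S' - p.1.2‖ < min r (1 / ((i.2 : ℝ) + 1)) ∧
        ∃ x, ‖A' x - (i.1 : Y)‖ < min r (1 / ((i.2 : ℝ) + 1)) := by
      by_cases hfin : FiniteDimensional 𝕜 (LinearMap.range (p.1.1 : X →ₗ[𝕜] Y))
      · exact p.2.exists_near_finite hX hfin _ hε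
      · exact p.2.exists_near_infinite hfin _ hε
    refine ⟨⟨(A', S'), hf⟩, ?_, x, hx.trans_le (min_le_right _ _)⟩
    rw [Metric.mem_ball, Subtype.dist_eq, Prod.dist_eq, max_lt_iff, dist_eq_norm, dist_eq_norm]
    exact ⟨hA'.trans_le (min_le_left _ _), hS'.trans_le (min_le_left _ _)⟩
  obtain ⟨p, hp⟩ := (dense_iInter_of_isOpen hUo hUd).nonempty
  refine ⟨p.1.1, p.1.2, p.2, ?_⟩
  have hDsub : D ⊆ closure (Set.range p.1.1) := by
    intro y hy
    refine Metric.mem_closure_iff.2 fun ε hε => ?_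
    obtain ⟨n, hn⟩ := exists_nat_one_div_lt hε
    obtain ⟨x, hx⟩ := Set.mem_iInter.1 hp (⟨y, hy⟩, n)
    refine ⟨_, ⟨x, rfl⟩, ?_⟩
    rw [dist_comm, dist_eq_norm]
    exact hx.trans hn
  exact dense_closure.1 (hD.mono hDsub)

end DenseRange


/-! ### One step of the construction, and gluing of the blocks. -/

section Stage

variable {X : Type v} {Y : Type w} [NormedAddCommGroup X] [NormedSpace 𝕜 X]
  [NormedAddCommGroup Y] [NormedSpace 𝕜 Y]

/-- One inductive step: `Φ` is the projection onto the part of `Y` already used, `p` the previous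
idempotent and `G` the next approximant of `T`. The subspaces fed to the local distance contain all
functionals factoring through `G`, `p` and `Φ`, which gives `G p' = G`, `p p' = p` and `Φ i j = Φ`.
-/
theorem exists_orthogonal_factorization (hX : IsReflexive 𝕜 X) (hY : IsReflexive 𝕜 Y) {K : ℕ → ℕ}
    {C : ℝ} (hC : 0 ≤ C) {n : ℕ} {ℓ : ℝ≥0}
    (hb : LocalDistBound 𝕜 K C (StrongDual 𝕜 X) (StrongDual 𝕜 Y) n ℓ)
    {f : ℕ → ℝ≥0} {d D : ℝ} (hD : PropertyD 𝕜 Y f d D) {r : ℕ} (hKr : K n ≤ r)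
    {G p : X →L[𝕜] X} {n₁ n₂ : ℕ} (hG : RankLE G n₁) (hp : RankLE p n₂) (hn : n₁ + n₂ ≤ n)
    {Φ : Y →L[𝕜] Y} (hΦ : Φ ∘L Φ = Φ) (hΦr : RankLE Φ n) {g : ℝ} (hΦg : ‖Φ‖ ≤ g) (hg : 1 ≤ g) :
    ∃ (p' : X →L[𝕜] X) (Q : Y →L[𝕜] Y) (i : X →L[𝕜] Y) (j : Y →L[𝕜] X),
      (‖p'‖ ≤ C ∧ RankLE p' r ∧ G ∘L p' = G ∧ p ∘L p' = p) ∧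
      (Q ∘L Q = Q ∧ RankLE Q r ∧ ‖Q‖ ≤ D * ((1 + 2 * C) * g) ^ d ∧ Φ ∘L Q = 0 ∧ Q ∘L Φ = 0) ∧
      j ∘L i = p' ∧ Q ∘L i = i ∧ j ∘L Q = j ∧
      ‖i‖ * ‖j‖ ≤ C ^ 2 * (ℓ + 1) *
        ((f r + 1) * ((1 + 2 * C) * g) * (D * ((1 + 2 * C) * g) ^ d)) := by
  obtain ⟨M₁, hM₁, hM₁n, hGM⟩ := hG.exists_dual
  obtain ⟨M₂, hM₂, hM₂n, hpM⟩ := hp.exists_dual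
  obtain ⟨M', hM', hM'n, hΦM⟩ := hΦr.exists_dual
  obtain ⟨i, j, -, hjij, hpC, hqC, hpr, hφ, hψ, hij⟩ :=
    hb.exists_factorization hX hY hC (M₁ ⊔ M₂) M' inferInstance hM'
      ((Submodule.finrank_add_le_finrank_add_finrank _ _).trans ((add_le_add hM₁n hM₂n).trans hn))
      hM'n
  replace hjij : ∀ y, j (i (j y)) = j y := DFunLike.congr_fun hjij
  have hGp : G ∘L (j ∘L i) = G := eq_of_forall_dual_comp_eq fun φ x =>
    DFunLike.congr_fun (hφ _ (Submodule.mem_sup_left (hGM φ))) x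
  have hpp : p ∘L (j ∘L i) = p := eq_of_forall_dual_comp_eq fun φ x =>
    DFunLike.congr_fun (hφ _ (Submodule.mem_sup_right (hpM φ))) x
  have hΦq : ∀ y, Φ (i (j y)) = Φ y := DFunLike.congr_fun <|
    eq_of_forall_dual_comp_eq (f := Φ ∘L (i ∘L j)) fun φ y =>
      DFunLike.congr_fun (hψ _ (hΦM φ)) y
  have hΦΦ : ∀ y, Φ (Φ y) = Φ y := DFunLike.congr_fun hΦ
  -- This idempotent has the kernel of `i ∘ j` and a range containing that of `Φ`. A copy orthogonal
  -- to `q` is therefore orthogonal to `Φ`, and `j ∘ q = j` lets the factorization pass through the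
  -- copy.
  let q : Y →L[𝕜] Y := Φ + i ∘L j - (i ∘L j) ∘L Φ
  have hqa : ∀ y, q y = Φ y + i (j y) - i (j (Φ y)) := fun y => rfl
  have hjq : ∀ y, j (q y) = j y := fun y => by simp [hqa, hjij]
  have hΦq' : ∀ y, Φ (q y) = Φ y := fun y => by simp [hqa, hΦq, hΦΦ]
  have hqij : ∀ y, q (i (j y)) = q y := fun y => by simp [hqa, hΦq, hjij]
  have hqΦ : ∀ y, q (Φ y) = Φ y := fun y => by simp [hqa, hΦΦ]
  have hqq : q ∘L q = q := by
    ext y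
    change q (q y) = q y
    rw [hqa (q y), hΦq', hjq, ← hqa]
  have hqr : RankLE q r := by
    have : q = (q ∘L i) ∘L ((j ∘L i) ∘L j) := by
      ext y
      simp [hjij, hqij]
    rw [this]
    exact ((hpr.mono hKr).comp_left _).comp_right _
  have hqg : ‖q‖ ≤ (1 + 2 * C) * g := by
    calc ‖q‖ ≤ ‖Φ‖ + ‖i ∘L j‖ + ‖(i ∘L j) ∘L Φ‖ :=
          norm_sub_le_of_le (norm_add_le _ _) le_rfl
      _ ≤ g + C + C * g := by
        gcongr
        exact (ContinuousLinearMap.opNorm_comp_le _ _).trans (by gcongr)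
      _ ≤ _ := by nlinarith
  obtain ⟨Q, u, v, hQ, hQr, hQn, hqQ, hQq, hvu, hQu, hvQ, huv⟩ :=
    hD.exists_orthogonal_copy hqq hqr (by positivity) hqg
  replace hqQ : ∀ y, q (Q y) = 0 := DFunLike.congr_fun hqQ
  replace hQq : ∀ y, Q (q y) = 0 := DFunLike.congr_fun hQq
  replace hvu : ∀ y, v (u y) = q y := DFunLike.congr_fun hvu
  replace hQu : ∀ y, Q (u y) = u y := DFunLike.congr_fun hQu
  replace hvQ : ∀ y, v (Q y) = v y := DFunLike.congr_fun hvQ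
  refine ⟨j ∘L i, Q, u ∘L i, j ∘L v, ⟨hpC, hpr.mono hKr, hGp, hpp⟩, ⟨hQ, hQr, hQn, ?_, ?_⟩,
    ?_, ?_, ?_, ?_⟩
  · ext y
    simpa [hqQ] using (hΦq' (Q y)).symm
  · ext y
    simpa [hqΦ] using hQq (Φ y)
  · ext x
    simp [hvu, hjq]
  · ext x
    simp [hQu]
  · ext y
    simp [hvQ]
  · calc ‖u ∘L i‖ * ‖j ∘L v‖ ≤ (‖u‖ * ‖i‖) * (‖j‖ * ‖v‖) := by
          gcongr <;> exact ContinuousLinearMap.opNorm_comp_le _ _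
      _ = (‖i‖ * ‖j‖) * (‖u‖ * ‖v‖) := by ring
      _ ≤ _ := by gcongr

/-- Balancing the norms of two operators by scalars. -/
theorem exists_balanced_smul {E F : Type*} [NormedAddCommGroup E] [NormedSpace 𝕜 E]
    [NormedAddCommGroup F] [NormedSpace 𝕜 F] (u : E) (v : F) {ρ : ℝ} (hρ : 0 < ρ)
    (h : ‖u‖ * ‖v‖ ≤ ρ ^ 2) :
    ∃ s t : 𝕜, ‖s • u‖ ≤ ρ ∧ ‖t • v‖ ≤ ρ ∧ (t * s = 1 ∨ u = 0) := by
  by_cases hu : u = 0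
  · exact ⟨0, 0, by simpa using hρ.le, by simpa using hρ.le, .inr hu⟩
  have hu' : 0 < ‖u‖ := norm_pos_iff.2 hu
  have hs : ((ρ / ‖u‖ : ℝ) : 𝕜) ≠ 0 := by
    rw [Ne, RCLike.ofReal_eq_zero]; positivity
  refine ⟨((ρ / ‖u‖ : ℝ) : 𝕜), ((ρ / ‖u‖ : ℝ) : 𝕜)⁻¹, ?_, ?_, .inl (inv_mul_cancel₀ hs)⟩
  · rw [norm_smul, RCLike.norm_ofReal, abs_of_pos (by positivity)]
    field_simp
    exact le_rfl
  · rw [norm_smul, norm_inv, RCLike.norm_ofReal, abs_of_pos (by positivity), inv_div,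
      div_mul_eq_mul_div, div_le_iff₀ hρ]
    nlinarith

theorem isCompactOperator_of_hasSum [CompleteSpace Y] {b : ℕ → X →L[𝕜] Y} {B : X →L[𝕜] Y}
    (hb : ∀ k, IsCompactOperator (b k)) (h : HasSum b B) : IsCompactOperator B := by
  refine isCompactOperator_of_tendsto (F := fun n => ∑ k ∈ Finset.range n, b k)
    h.tendsto_sum_nat (Filter.Eventually.of_forall fun n => ?_)
  induction n with
  | zero => simpa using isCompactOperator_zero
  | succ n ih => rw [Finset.sum_range_succ]; exact ih.add (hb n)

/-- A factorization of `T` glued from factorizations `p (k + 1) = j k ∘ i k` through mutually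
orthogonal parts of `Y`. -/
theorem exists_isFactorization_of_blocks [CompleteSpace X] [CompleteSpace Y] (T : X →L[𝕜] X)
    (p : ℕ → X →L[𝕜] X) (Φ Q : ℕ → Y →L[𝕜] Y) (i : ℕ → X →L[𝕜] Y) (j : ℕ → Y →L[𝕜] X)
    (hp0 : p 0 = 0) (hp : ∀ k, p k ∘L p (k + 1) = p k)
    (hΦ : ∀ k, Φ (k + 1) = Φ k + Q k) (hQ : ∀ k, Q k ∘L Q k = Q k)
    (hΦQ : ∀ k, Φ k ∘L Q k = 0) (hQΦ : ∀ k, Q k ∘L Φ k = 0) (hQr : ∀ k, ∃ r, RankLE (Q k) r)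
    (hji : ∀ k, j k ∘L i k = p (k + 1)) (hQi : ∀ k, Q k ∘L i k = i k)
    (hjQ : ∀ k, j k ∘L Q k = j k) {c : ℝ} (hc : 0 < c)
    (hn : ∀ k, ‖i k‖ * ‖T ∘L (ContinuousLinearMap.id 𝕜 X - p k) ∘L j k‖ ≤ c * (1 / 4) ^ k)
    (hlim : Filter.Tendsto (fun k => T ∘L p k) Filter.atTop (nhds T)) :
    ∃ (A : X →L[𝕜] Y) (S : Y →L[𝕜] X), IsFactorization T A S := by
  have hQ' : ∀ k y, Q k (Q k y) = Q k y := fun k => DFunLike.congr_fun (hQ k)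
  have hΦQ' : ∀ k y, Φ k (Q k y) = 0 := fun k => DFunLike.congr_fun (hΦQ k)
  have hQΦ' : ∀ k y, Q k (Φ k y) = 0 := fun k => DFunLike.congr_fun (hQΦ k)
  have hΦs : ∀ k y, Φ (k + 1) y = Φ k y + Q k y := fun k y => by rw [hΦ]; rfl
  -- Each later `Φ` is the identity on the range of `Q l` and is absorbed by `Q l`; with the
  -- orthogonality of `Φ k` and `Q k` this makes all the `Q k` mutually orthogonal.
  have hlt : ∀ l n y, Q l (Φ (l + 1 + n) y) = Q l y ∧ Φ (l + 1 + n) (Q l y) = Q l y := by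
    intro l n
    induction n with
    | zero => intro y; simp [hΦs, hQΦ', hΦQ', hQ']
    | succ n ih =>
      intro y
      have h1 : Q l (Q (l + 1 + n) y) = 0 := by
        rw [← (ih _).1, hΦQ', map_zero]
      have h2 : Q (l + 1 + n) (Q l y) = 0 := by
        rw [← (ih _).2, hQΦ']
      rw [← add_assoc, hΦs, hΦs, map_add, (ih y).1, (ih y).2, h1, h2]
      simp
  have hortho : ∀ l k, l ≠ k → ∀ y, Q l (Q k y) = 0 := by
    intro l k hlk y
    rcases lt_or_gt_of_ne hlk with h | h
    · obtain ⟨n, rfl⟩ := Nat.exists_eq_add_of_le (Nat.succ_le_of_lt h)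
      rw [← (hlt l n _).1, hΦQ', map_zero]
    · obtain ⟨n, rfl⟩ := Nat.exists_eq_add_of_le (Nat.succ_le_of_lt h)
      rw [← (hlt k n _).2, hQΦ']
  let a₀ : ℕ → Y →L[𝕜] X := fun k => T ∘L (ContinuousLinearMap.id 𝕜 X - p k) ∘L j k
  have hbal : ∀ k, ∃ s t : 𝕜, ‖s • i k‖ ≤ Real.sqrt c * (1 / 2) ^ k ∧
      ‖t • a₀ k‖ ≤ Real.sqrt c * (1 / 2) ^ k ∧ (t * s = 1 ∨ i k = 0) := by
    intro k
    refine exists_balanced_smul (i k) (a₀ k) (by positivity) ((hn k).trans_eq ?_)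
    rw [mul_pow, Real.sq_sqrt hc.le, ← pow_mul, mul_comm k, pow_mul]
    norm_num
  choose s t hs ht hst using hbal
  have hgeo : Summable fun k : ℕ => Real.sqrt c * (1 / 2) ^ k :=
    (summable_geometric_of_lt_one (by norm_num) (by norm_num)).mul_left _
  have hA := (Summable.of_norm_bounded hgeo hs).hasSum
  have hS := (Summable.of_norm_bounded hgeo ht).hasSum
  set A := ∑' k, s k • i k
  set S := ∑' k, t k • a₀ k
  have hQi' : ∀ k x, Q k (i k x) = i k x := fun k => DFunLike.congr_fun (hQi k)
  have hjQ' : ∀ k y, j k (Q k y) = j k y := fun k => DFunLike.congr_fun (hjQ k)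
  have hSA : ∀ k x, S (s k • i k x) = T (p (k + 1) x) - T (p k x) := by
    intro k x
    have h1 : HasSum (fun l => (t l • a₀ l) (s k • i k x)) (S (s k • i k x)) :=
      hS.mapL (ContinuousLinearMap.apply 𝕜 X (s k • i k x))
    have h2 : HasSum (fun l => (t l • a₀ l) (s k • i k x)) ((t k • a₀ k) (s k • i k x)) := by
      refine hasSum_single k fun l hl => ?_
      have : j l (i k x) = 0 := by
        rw [← hjQ', ← hQi' k, hortho l k hl, map_zero]
      simp [a₀, this]
    rw [h1.unique h2]
    have h3 : j k (i k x) = p (k + 1) x := DFunLike.congr_fun (hji k) x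
    have h4 : p k (p (k + 1) x) = p k x := DFunLike.congr_fun (hp k) x
    have h5 : (t k • a₀ k) (s k • i k x) = (t k * s k) • (T (p (k + 1) x) - T (p k x)) := by
      simp [a₀, h3, h4, smul_smul, mul_comm]
    rw [h5]
    rcases hst k with h | h
    · rw [h, one_smul]
    -- If `i k = 0`, then `p (k + 1) = 0` and so `p k = p k ∘ p (k + 1) = 0`: the term vanishes
    -- whatever the weights.
    · have h6 : p (k + 1) x = 0 := by rw [← h3, h]; simp
      rw [← h4, h6]
      simp
  refine ⟨A, S, ⟨?_, ?_, ?_, ?_⟩⟩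
  · refine isCompactOperator_of_hasSum (fun k => ?_) hA
    obtain ⟨r, hr⟩ := hQr k
    rw [← hQi k]
    exact (hr.comp_left _).isCompactOperator.smul _
  · refine isCompactOperator_of_hasSum (fun k => ?_) hS
    obtain ⟨r, hr⟩ := hQr k
    have : a₀ k = (T ∘L (ContinuousLinearMap.id 𝕜 X - p k) ∘L j k) ∘L Q k := by
      ext y; simp [a₀, hjQ']
    rw [this]
    exact (hr.comp_right _).isCompactOperator.smul _
  · ext x
    have h1 : HasSum (fun k => S (s k • i k x)) (S (A x)) :=
      (hA.mapL (ContinuousLinearMap.apply 𝕜 Y x)).mapL S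
    simp only [hSA] at h1
    have h2 := h1.tendsto_sum_nat
    simp only [Finset.sum_range_sub (fun k => T (p k x)), hp0, zero_apply, map_zero,
      sub_zero] at h2
    have h3 : Filter.Tendsto (fun k => T (p k x)) Filter.atTop (nhds (T x)) :=
      ((ContinuousLinearMap.apply 𝕜 X x).continuous.tendsto T).comp hlim
    exact tendsto_nhds_unique h2 h3
  · intro y
    have h1 : HasSum (fun k => (t k • a₀ k) y) (S y) :=
      hS.mapL (ContinuousLinearMap.apply 𝕜 X y)
    refine (LinearMap.range (T : X →ₗ[𝕜] X)).isClosed_topologicalClosure.mem_of_tendsto h1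
      (Filter.Eventually.of_forall fun F => ?_)
    refine Submodule.sum_mem _ fun k _ => Submodule.le_topologicalClosure _ ?_
    exact ⟨t k • (ContinuousLinearMap.id 𝕜 X - p k) (j k y), by simp [a₀]⟩

end Stage


theorem exists_dependent_seq {σ : ℕ → Type*} (s₀ : σ 0) {R : ∀ k, σ k → σ (k + 1) → Prop}
    (h : ∀ k s, ∃ s', R k s s') : ∃ s : ∀ k, σ k, s 0 = s₀ ∧ ∀ k, R k (s k) (s (k + 1)) := by
  choose next hnext using h
  exact ⟨fun k => Nat.rec s₀ next k, rfl, fun k => hnext k _⟩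

/-! ### The recursive construction of the blocks. -/

section Recursion

variable {X : Type v} {Y : Type w} [NormedAddCommGroup X] [NormedSpace 𝕜 X]
  [NormedAddCommGroup Y] [NormedSpace 𝕜 Y]

theorem exists_isFactorization_of_bounds [CompleteSpace X] [CompleteSpace Y]
    (hX : IsReflexive 𝕜 X) (hY : IsReflexive 𝕜 Y)
    {K : ℕ → ℕ} {C : ℝ} (hC : 0 ≤ C) {f : ℕ → ℝ≥0} {d D : ℝ} (hD : PropertyD 𝕜 Y f d D)
    {m : ℕ → ℕ} {ℓ : ℕ → ℝ≥0} {g : ℕ → ℝ} (T : X →L[𝕜] X) (G : ℕ → X →L[𝕜] X)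
    (hb : ∀ k, LocalDistBound 𝕜 K C (StrongDual 𝕜 X) (StrongDual 𝕜 Y) (4 * m (k + 1)) (ℓ k))
    (hKm : ∀ k, K (4 * m (k + 1)) ≤ m (k + 2)) (hm : ∀ k, 4 * m (k + 1) ≤ m (k + 2))
    (hg : ∀ k, 1 ≤ g k) (hgs : ∀ k, g k + D * ((1 + 2 * C) * g k) ^ d ≤ g (k + 1))
    (hG0 : G 0 = 0) (hG : ∀ k, RankLE (G k) (m k)) {c : ℝ} (hc : 0 < c)
    (hGT : Filter.Tendsto G Filter.atTop (nhds T))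
    (hbound : ∀ k, (1 + C) * ‖T - G k‖ * (C ^ 2 * (ℓ k + 1) *
      ((f (m (k + 2)) + 1) * ((1 + 2 * C) * g k) * (D * ((1 + 2 * C) * g k) ^ d))) ≤
        c * (1 / 4) ^ k) :
    ∃ (A : X →L[𝕜] Y) (S : Y →L[𝕜] X), IsFactorization T A S := by
  let Inv : ℕ → (X →L[𝕜] X) × (Y →L[𝕜] Y) → Prop := fun k s =>
    (‖s.1‖ ≤ C ∧ RankLE s.1 (m (k + 1)) ∧ G k ∘L s.1 = G k) ∧
      s.2 ∘L s.2 = s.2 ∧ RankLE s.2 (4 * m (k + 1)) ∧ ‖s.2‖ ≤ g k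
  have h0 : Inv 0 (0, 0) := ⟨⟨by simpa using hC, rankLE_zero _, by simp [hG0]⟩, by simp,
    rankLE_zero _, by simpa using zero_le_one.trans (hg 0)⟩
  let B : ℕ → ℝ := fun k => C ^ 2 * (ℓ k + 1) *
    ((f (m (k + 2)) + 1) * ((1 + 2 * C) * g k) * (D * ((1 + 2 * C) * g k) ^ d))
  let R : ∀ k, {s // Inv k s} → {s // Inv (k + 1) s} → Prop := fun k s s' =>
    ∃ (Q : Y →L[𝕜] Y) (i : X →L[𝕜] Y) (j : Y →L[𝕜] X),
      s.1.1 ∘L s'.1.1 = s.1.1 ∧ s'.1.2 = s.1.2 + Q ∧ Q ∘L Q = Q ∧ s.1.2 ∘L Q = 0 ∧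
      Q ∘L s.1.2 = 0 ∧ RankLE Q (m (k + 2)) ∧ j ∘L i = s'.1.1 ∧ Q ∘L i = i ∧ j ∘L Q = j ∧
      ‖i‖ * ‖j‖ ≤ B k
  have hstep : ∀ k s, ∃ s', R k s s' := by
    rintro k ⟨⟨p, Φ⟩, ⟨-, hpr, -⟩, hΦ, hΦr, hΦg⟩
    obtain ⟨p', Q, i, j, ⟨h1, h2, h3, h4⟩, ⟨h5, h6, h7, h8, h9⟩, h10, h11, h12, h13⟩ :=
      exists_orthogonal_factorization hX hY hC (hb k) hD (hKm k) (hG (k + 1)) hpr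
        (by omega) hΦ hΦr hΦg (hg k)
    have hsum : (Φ + Q) ∘L (Φ + Q) = Φ + Q := by
      simp only [ContinuousLinearMap.comp_add, ContinuousLinearMap.add_comp]
      rw [hΦ, h5, h8, h9]
      simp
    exact ⟨⟨(p', Φ + Q), ⟨h1, h2, h3⟩, hsum, (hΦr.add h6).mono
      -- Rank count: `4 * m (k + 1) + m (k + 2) ≤ 2 * m (k + 2)`.
      (by change _ ≤ 4 * m (k + 2); have := hm k; omega),
      (norm_add_le _ _).trans ((add_le_add hΦg h7).trans (hgs k))⟩, Q, i, j, h4, rfl, h5, h8, h9,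
      h6, h10, h11, h12, h13⟩
  obtain ⟨s, hs0, hs⟩ := exists_dependent_seq (σ := fun k => {s // Inv k s}) ⟨(0, 0), h0⟩ hstep
  choose Q i j h1 h2 h3 h4 h5 h6 h7 h8 h9 h10 using hs
  have hTp : ∀ k, ‖T ∘L (ContinuousLinearMap.id 𝕜 X - (s k).1.1)‖ ≤ (1 + C) * ‖T - G k‖ := by
    intro k
    have hGp : G k ∘L (s k).1.1 = G k := (s k).2.1.2.2
    have : T ∘L (ContinuousLinearMap.id 𝕜 X - (s k).1.1) =
        (T - G k) ∘L (ContinuousLinearMap.id 𝕜 X - (s k).1.1) := by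
      simp [ContinuousLinearMap.comp_sub, ContinuousLinearMap.sub_comp, hGp]
    rw [this]
    calc _ ≤ ‖T - G k‖ * ‖ContinuousLinearMap.id 𝕜 X - (s k).1.1‖ :=
          ContinuousLinearMap.opNorm_comp_le _ _
      _ ≤ ‖T - G k‖ * (1 + C) := by
        gcongr
        exact norm_sub_le_of_le ContinuousLinearMap.norm_id_le (s k).2.1.1
      _ = _ := mul_comm _ _
  refine exists_isFactorization_of_blocks T (fun k => (s k).1.1) (fun k => (s k).1.2) Q i j
    (by simp [hs0]) h1 h2 h3 h4 h5 (fun k => ⟨_, h6 k⟩) h7 h8 h9 hc (fun k => ?_) ?_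
  · have h11 : ‖T ∘L (ContinuousLinearMap.id 𝕜 X - (s k).1.1) ∘L j k‖ ≤
        (1 + C) * ‖T - G k‖ * ‖j k‖ := by
      rw [← ContinuousLinearMap.comp_assoc]
      exact (ContinuousLinearMap.opNorm_comp_le _ _).trans (by gcongr; exact hTp k)
    calc _ ≤ ‖i k‖ * ((1 + C) * ‖T - G k‖ * ‖j k‖) := by gcongr
      _ = (1 + C) * ‖T - G k‖ * (‖i k‖ * ‖j k‖) := by ring
      _ ≤ (1 + C) * ‖T - G k‖ * B k := by gcongr; exact h10 k
      _ ≤ _ := hbound k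
  · rw [tendsto_iff_norm_sub_tendsto_zero]
    have h11 : Filter.Tendsto (fun k => (1 + C) * ‖T - G k‖) Filter.atTop (nhds 0) := by
      have := (tendsto_iff_norm_sub_tendsto_zero.1 hGT).const_mul (1 + C)
      simpa [norm_sub_rev] using this
    refine squeeze_zero (fun _ => norm_nonneg _) (fun k => ?_) h11
    rw [norm_sub_rev]
    simpa [ContinuousLinearMap.comp_sub] using hTp k

end Recursion

/-! ### Consequences for dimensions and constants. -/

section Dimension

variable {X : Type v} {Y : Type w} [NormedAddCommGroup X] [NormedSpace 𝕜 X]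
  [NormedAddCommGroup Y] [NormedSpace 𝕜 Y]

theorem one_le_norm_of_isProj {M : Submodule 𝕜 X} {P : X →L[𝕜] X} (hP : LinearMap.IsProj M P)
    (hM : M ≠ ⊥) : 1 ≤ ‖P‖ := by
  obtain ⟨x, hx, hx0⟩ := M.exists_mem_ne_zero_of_ne_bot hM
  have h := P.le_opNorm x
  rw [hP.map_id x hx] at h
  exact (le_mul_iff_one_le_left (norm_pos_iff.2 hx0)).1 h

/-- A nonzero projection has norm at least 1, so `c ≥ 1` and `c ^ d` increases with `d`. -/
theorem PropertyD.mono_const {f : ℕ → ℝ≥0} {d D d' D' : ℝ} (h : PropertyD 𝕜 X f d D)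
    (hd : d ≤ d') (hD : D ≤ D') : PropertyD 𝕜 X f d' D' where
  mono := h.mono
  d_nonneg := h.d_nonneg.trans hd
  D_pos := h.D_pos.trans_le hD
  exists_copy n hn c M P hM hMn hP hPc := by
    obtain ⟨N, Q, h1, h2, h3, h4, h5, h6⟩ := h.exists_copy n hn c M P hM hMn hP hPc
    have hc : 1 ≤ c := (one_le_norm_of_isProj hP (by
      rintro rfl
      simp at hMn
      omega)).trans hPc
    refine ⟨N, Q, h1, h2, h3, h4, h5.trans ?_, h6⟩
    have := h.D_pos
    have := this.trans_le hD
    gcongr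

/-- The whole space, if finite dimensional and nonzero, leaves no room for a disjoint copy of
itself. -/
theorem PropertyD.subsingleton {f : ℕ → ℝ≥0} {d D : ℝ} (h : PropertyD 𝕜 X f d D)
    (hX : FiniteDimensional 𝕜 X) : Subsingleton X := by
  by_contra hs
  rw [not_subsingleton_iff_nontrivial] at hs
  have hpos : 0 < finrank 𝕜 X := finrank_pos
  obtain ⟨N, Q, -, h2, -, h4, -⟩ := h.exists_copy (finrank 𝕜 X) hpos _ ⊤
    (ContinuousLinearMap.id 𝕜 X) inferInstance (finrank_top 𝕜 X)
    ⟨fun _ => trivial, fun _ _ => rfl⟩ le_rfl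
  rw [top_inf_eq] at h4
  rw [h4, finrank_bot] at h2
  omega

/-- Test on a rank-one projection of norm one: the copy is a nonzero projection of norm at most `D`.
-/
theorem PropertyD.one_le {f : ℕ → ℝ≥0} {d D : ℝ} (h : PropertyD 𝕜 X f d D) [Nontrivial X] :
    1 ≤ D := by
  obtain ⟨x, hx⟩ := exists_ne (0 : X)
  obtain ⟨φ, hφ, hφx⟩ := exists_dual_vector 𝕜 x (norm_ne_zero_iff.2 hx)
  have hx' : ((‖x‖ : ℝ) : 𝕜) ≠ 0 := by simpa using hx
  let P : X →L[𝕜] X := φ.smulRight ((‖x‖ : 𝕜)⁻¹ • x)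
  have hP : LinearMap.IsProj (𝕜 ∙ x) P := by
    refine ⟨fun y => ?_, fun y hy => ?_⟩
    · exact Submodule.smul_mem _ _ (Submodule.smul_mem _ _ (Submodule.mem_span_singleton_self x))
    · obtain ⟨a, rfl⟩ := Submodule.mem_span_singleton.1 hy
      simp only [P, ContinuousLinearMap.smulRight_apply, map_smul, hφx, smul_smul]
      rw [mul_inv_cancel₀ hx', mul_one]
  have hPn : ‖P‖ ≤ 1 := by
    rw [ContinuousLinearMap.norm_smulRight_apply, hφ, norm_smul]
    simp [hx]
  obtain ⟨N, Q, -, hN, hQ, -, hQn, -⟩ :=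
    h.exists_copy 1 le_rfl 1 (𝕜 ∙ x) P inferInstance (finrank_span_singleton hx) hP hPn
  have := one_le_norm_of_isProj hQ (by rintro rfl; simp at hN)
  simpa using this.trans hQn

theorem exists_submodule_finrank_eq (hX : ¬ FiniteDimensional 𝕜 X) (n : ℕ) :
    ∃ M : Submodule 𝕜 X, FiniteDimensional 𝕜 M ∧ finrank 𝕜 M = n := by
  have h1 : (n : Cardinal) ≤ Module.rank 𝕜 X := by
    refine Cardinal.natCast_le_aleph0.trans ?_
    by_contra h
    exact hX (Module.rank_lt_aleph0_iff.1 (not_le.1 h))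
  obtain ⟨s, hs, hli⟩ := le_rank_iff_exists_linearIndependent_finset.1 h1
  refine ⟨Submodule.span 𝕜 (s : Set X), FiniteDimensional.span_finset 𝕜 s, ?_⟩
  rw [finrank_span_finset_eq_card hli, hs]

theorem finiteDimensional_strongDual_iff :
    FiniteDimensional 𝕜 (StrongDual 𝕜 X) ↔ FiniteDimensional 𝕜 X := by
  constructor
  · intro h
    let Ψ : X →ₗ[𝕜] Dual 𝕜 (StrongDual 𝕜 X) :=
      ContinuousLinearMap.coeLM 𝕜 ∘ₗ (NormedSpace.inclusionInDoubleDual 𝕜 X : X →ₗ[𝕜] _)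
    refine FiniteDimensional.of_injective Ψ fun x y hxy => ?_
    exact (SeparatingDual.eq_iff_forall_dual_eq (R := 𝕜)).2 fun φ => LinearMap.congr_fun hxy φ
  · intro h
    exact FiniteDimensional.of_injective (V₂ := Dual 𝕜 X) (ContinuousLinearMap.coeLM 𝕜)
      ContinuousLinearMap.coe_injective

/-- Testing on an `n`-dimensional subspace of `Y` yields both `n ≤ K n` and the lower bound 1 for
the local distance. -/
theorem LocalDistBound.le_right {K : ℕ → ℕ} {C : ℝ} {n : ℕ} {f : ℝ≥0}
    (h : LocalDistBound 𝕜 K C X Y n f) (hY : ¬ FiniteDimensional 𝕜 Y) :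
    ∃ N : Submodule 𝕜 X, FiniteDimensional 𝕜 N ∧ n ≤ finrank 𝕜 N ∧ finrank 𝕜 N ≤ K n ∧
      (1 ≤ n → 1 ≤ f) := by
  obtain ⟨M', hM', hM'n⟩ := exists_submodule_finrank_eq hY n
  obtain ⟨N, N', hN, hN', -, -, -, hMN', heq, hK, hd⟩ :=
    h ⊥ M' inferInstance hM' (by simp) hM'n.le
  have hn : n ≤ finrank 𝕜 N := by
    rw [heq, ← hM'n]
    exact Submodule.finrank_mono hMN'
  refine ⟨N, hN, hn, hK, fun h1 => ?_⟩
  have : Nontrivial N := finrank_pos_iff.1 (by omega : 0 < finrank 𝕜 N)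
  exact_mod_cast one_le_banachMazur.trans hd

theorem exists_localDistBound {K : ℕ → ℕ} {C : ℝ} {n : ℕ} {b : ℝ≥0∞}
    (h : localDist 𝕜 K C X Y n < b) : ∃ f : ℝ≥0, (f : ℝ≥0∞) < b ∧ LocalDistBound 𝕜 K C X Y n f := by
  obtain ⟨f, hf⟩ := iInf_lt_iff.1 h
  obtain ⟨hf1, hf2⟩ := iInf_lt_iff.1 hf
  exact ⟨f, hf2, hf1⟩

theorem not_finiteDimensional_left {K : ℕ → ℕ} {C : ℝ}
    (hfin : ∀ n : ℕ, 1 ≤ n → localDist 𝕜 K C X Y n < ∞) (hY : ¬ FiniteDimensional 𝕜 Y) :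
    ¬ FiniteDimensional 𝕜 X := by
  intro hX
  obtain ⟨f, -, hf⟩ := exists_localDistBound (hfin (finrank 𝕜 X + 1) (by omega))
  obtain ⟨N, -, hN, -⟩ := hf.le_right hY
  have := Submodule.finrank_le N
  omega

theorem not_finiteDimensional_right {K : ℕ → ℕ} {C : ℝ}
    (hfin : ∀ n : ℕ, 1 ≤ n → localDist 𝕜 K C X Y n < ∞) (hX : ¬ FiniteDimensional 𝕜 X) :
    ¬ FiniteDimensional 𝕜 Y := by
  intro hY
  obtain ⟨f, -, hf⟩ := exists_localDistBound (hfin (finrank 𝕜 Y + 1) (by omega))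
  obtain ⟨M, hM, hMn⟩ := exists_submodule_finrank_eq hX (finrank 𝕜 Y + 1)
  obtain ⟨N, N', hN, -, -, -, hMN, -, heq, -⟩ := hf M ⊥ hM inferInstance hMn.le (by simp)
  have h1 := Submodule.finrank_mono hMN
  have h2 := Submodule.finrank_le N'
  omega

theorem one_le_localDist {K : ℕ → ℕ} {C : ℝ} {n : ℕ} (hn : 1 ≤ n)
    (hY : ¬ FiniteDimensional 𝕜 Y) : 1 ≤ localDist 𝕜 K C X Y n := by
  refine le_iInf fun f => le_iInf fun hf => ?_
  obtain ⟨-, -, -, -, h⟩ := hf.le_right hY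
  exact_mod_cast h hn

end Dimension


/-! ### Growth of the constants `C(k)`. -/

section Growth

variable {C d D : ℝ}

theorem pow_le_growthConst (hC : 1 ≤ C) (hd : 1 ≤ d) (hD : 1 ≤ D) (k : ℕ) :
    (4 * D * (C + 3)) ^ (k + 1) ≤ growthConst C d D k := by
  have hb : 1 ≤ 4 * D * (C + 3) := by nlinarith
  rw [growthConst, ← Real.rpow_natCast]
  refine Real.rpow_le_rpow_of_exponent_le hb ?_
  push_cast
  exact le_mul_of_one_le_right (by positivity) (one_le_pow₀ hd)

theorem one_le_growthConst (hC : 1 ≤ C) (hd : 1 ≤ d) (hD : 1 ≤ D) (k : ℕ) :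
    1 ≤ growthConst C d D k := by
  have hb : 1 ≤ 4 * D * (C + 3) := by nlinarith
  exact (one_le_pow₀ hb).trans (pow_le_growthConst hC hd hD k)

/-- This is the recursion for the norms of the accumulated projections. Raising `C(k)` to the power
`d` turns its exponent into `(k + 1) d ^ (k + 1)`; the missing `d ^ (k + 1)` absorbs the factor `2 D
(1 + 2 C) ^ d`. -/
theorem growthConst_step (hC : 1 ≤ C) (hd : 1 ≤ d) (hD : 1 ≤ D) (k : ℕ) :
    growthConst C d D k + D * ((1 + 2 * C) * growthConst C d D k) ^ d ≤
      growthConst C d D (k + 1) := by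
  have hb : 1 ≤ 4 * D * (C + 3) := by nlinarith
  have hg := one_le_growthConst hC hd hD k
  have h1 : growthConst C d D k ≤ D * ((1 + 2 * C) * growthConst C d D k) ^ d := by
    have h2 : growthConst C d D k ≤ (1 + 2 * C) * growthConst C d D k := by nlinarith
    have h3 : (1 + 2 * C) * growthConst C d D k ≤ ((1 + 2 * C) * growthConst C d D k) ^ d :=
      Real.self_le_rpow_of_one_le (hg.trans h2) hd
    nlinarith
  have h4 : growthConst C d D k ^ d = (4 * D * (C + 3)) ^ (((k : ℝ) + 1) * d ^ (k + 1)) := by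
    rw [growthConst, ← Real.rpow_mul (by positivity), pow_succ, mul_assoc ((k : ℝ) + 1)]
  have h5 : 2 * D * (1 + 2 * C) ^ d ≤ (4 * D * (C + 3)) ^ (d ^ (k + 1)) := by
    calc 2 * D * (1 + 2 * C) ^ d ≤ (2 * D) ^ d * (1 + 2 * C) ^ d := by
          gcongr
          exact Real.self_le_rpow_of_one_le (by linarith) hd
      _ = (2 * D * (1 + 2 * C)) ^ d := (Real.mul_rpow (by positivity) (by positivity)).symm
      _ ≤ (4 * D * (C + 3)) ^ d := by
        gcongr ?_ ^ d
        nlinarith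
      _ ≤ _ := Real.rpow_le_rpow_of_exponent_le hb (le_self_pow₀ hd (by simp))
  calc _ ≤ 2 * (D * ((1 + 2 * C) * growthConst C d D k) ^ d) := by linarith
    _ = 2 * D * (1 + 2 * C) ^ d * growthConst C d D k ^ d := by
      rw [Real.mul_rpow (by positivity) (by positivity)]; ring
    _ ≤ (4 * D * (C + 3)) ^ (d ^ (k + 1)) * growthConst C d D k ^ d := by gcongr
    _ = growthConst C d D (k + 1) := by
      rw [h4, ← Real.rpow_add (by positivity), growthConst]
      congr 1
      push_cast
      ring

theorem growthConst_mono (hC : 1 ≤ C) (hd : 1 ≤ d) (hD : 1 ≤ D) (k : ℕ) :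
    growthConst C d D k ≤ growthConst C d D (k + 1) := by
  have h := growthConst_step hC hd hD k
  have hg := one_le_growthConst hC hd hD k
  have : 0 ≤ D * ((1 + 2 * C) * growthConst C d D k) ^ d := by positivity
  linarith

/-- Each of `(1 + C) C ^ 2` and the two factors containing `growthConst C d D k` is at most `C(k +
2)`. -/
theorem growthConst_bound (hC : 1 ≤ C) (hd : 1 ≤ d) (hD : 1 ≤ D) (k : ℕ) :
    (1 + C) * C ^ 2 * (((1 + 2 * C) * growthConst C d D k) *
      (D * ((1 + 2 * C) * growthConst C d D k) ^ d)) ≤ growthConst C d D (k + 2) ^ 3 := by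
  have hb : 1 ≤ 4 * D * (C + 3) := by nlinarith
  have hg := one_le_growthConst hC hd hD k
  have hg1 := one_le_growthConst hC hd hD (k + 1)
  have h1 := growthConst_step hC hd hD k
  have h2 := growthConst_mono hC hd hD (k + 1)
  have h3 : D * ((1 + 2 * C) * growthConst C d D k) ^ d ≤ growthConst C d D (k + 2) := by
    refine le_trans ?_ h2
    linarith
  have h4 : (1 + 2 * C) * growthConst C d D k ≤ growthConst C d D (k + 2) := by
    refine le_trans ?_ h3
    have h5 : (1 + 2 * C) * growthConst C d D k ≤ ((1 + 2 * C) * growthConst C d D k) ^ d :=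
      Real.self_le_rpow_of_one_le (by nlinarith) hd
    exact h5.trans (le_mul_of_one_le_left (by positivity) hD)
  have h6 : (1 + C) * C ^ 2 ≤ growthConst C d D (k + 2) := by
    calc (1 + C) * C ^ 2 ≤ (4 * D * (C + 3)) * (4 * D * (C + 3)) ^ 2 := by
          gcongr <;> nlinarith
      _ = (4 * D * (C + 3)) ^ 3 := by ring
      _ ≤ (4 * D * (C + 3)) ^ (k + 2 + 1) := pow_le_pow_right₀ hb (by omega)
      _ ≤ _ := pow_le_growthConst hC hd hD (k + 2)
  have hg2 : 0 ≤ growthConst C d D (k + 2) := zero_le_one.trans (hg1.trans h2)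
  calc _ ≤ growthConst C d D (k + 2) * (growthConst C d D (k + 2) * growthConst C d D (k + 2)) := by
        gcongr
    _ = _ := by ring

/-- Of the five powers in the hypothesis on the local distance, three pay for the constants of a
block; the other two give geometric decay, the base being at least 4. -/
theorem growthConst_decay (hC : 1 ≤ C) (hd : 1 ≤ d) (hD : 1 ≤ D) (k : ℕ) :
    growthConst C d D (k + 2) ^ 3 * (growthConst C d D (k + 2) ^ 5)⁻¹ ≤ (1 / 4) ^ k := by
  have hg := one_le_growthConst hC hd hD (k + 2)
  have hb : 4 ≤ 4 * D * (C + 3) := by nlinarith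
  have h1 : (4 : ℝ) ^ k ≤ growthConst C d D (k + 2) ^ 2 := by
    calc (4 : ℝ) ^ k ≤ (4 * D * (C + 3)) ^ k := by gcongr
      _ ≤ (4 * D * (C + 3)) ^ (k + 2 + 1) := pow_le_pow_right₀ (by linarith) (by omega)
      _ ≤ growthConst C d D (k + 2) := pow_le_growthConst hC hd hD (k + 2)
      _ ≤ growthConst C d D (k + 2) ^ 2 := le_self_pow₀ hg (by simp)
  calc growthConst C d D (k + 2) ^ 3 * (growthConst C d D (k + 2) ^ 5)⁻¹ =
        (growthConst C d D (k + 2) ^ 2)⁻¹ := by field_simp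
    _ ≤ ((4 : ℝ) ^ k)⁻¹ := by gcongr
    _ = _ := by rw [one_div, inv_pow]

end Growth

/-! ### Approximation numbers and the balance of exponents. -/

section Approximation

variable {X : Type v} {Y : Type w} [NormedAddCommGroup X] [NormedSpace 𝕜 X]
  [NormedAddCommGroup Y] [NormedSpace 𝕜 Y]

theorem approxNumber_le_enorm (T : X →L[𝕜] Y) {n : ℕ} (hn : 1 ≤ n) : approxNumber T n ≤ ‖T‖ₑ := by
  refine (iInf₂_le (0 : X →L[𝕜] Y) ?_).trans (by simp)
  simp only [ContinuousLinearMap.toLinearMap_zero, LinearMap.rank_zero]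
  exact_mod_cast hn

theorem approxNumber_ne_top (T : X →L[𝕜] Y) {n : ℕ} (hn : 1 ≤ n) : approxNumber T n ≠ ∞ :=
  ((approxNumber_le_enorm T hn).trans_lt enorm_lt_top).ne

theorem toReal_approxNumber_le (T : X →L[𝕜] Y) {n : ℕ} (hn : 1 ≤ n) :
    (approxNumber T n).toReal ≤ ‖T‖ := by
  rw [← toReal_enorm]
  exact ENNReal.toReal_mono enorm_ne_top (approxNumber_le_enorm T hn)

theorem exists_rankLE_norm_sub_lt (T : X →L[𝕜] Y) {n : ℕ} (hn : 1 ≤ n) {δ : ℝ}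
    (h : (approxNumber T n).toReal < δ) : ∃ S : X →L[𝕜] Y, RankLE S n ∧ ‖T - S‖ < δ := by
  have h1 : approxNumber T n < ENNReal.ofReal δ :=
    (ENNReal.lt_ofReal_iff_toReal_lt (approxNumber_ne_top T hn)).2 h
  obtain ⟨S, hS⟩ := iInf_lt_iff.1 h1
  obtain ⟨hSr, hS⟩ := iInf_lt_iff.1 hS
  refine ⟨S, rankLE_of_rank_lt hSr, ?_⟩
  rw [← ofReal_norm] at hS
  exact (ENNReal.ofReal_lt_ofReal_iff'.1 hS).1

/-- Moving the negative power to the left turns the extended inequality into a real one that also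
covers `a = 0`, where the right-hand side may be infinite. -/
theorem toReal_mul_rpow_le {x a : ℝ≥0∞} {c s : ℝ} (hc : 0 ≤ c)
    (h : x ≤ ENNReal.ofReal c * a ^ (-s)) : x.toReal * a.toReal ^ s ≤ c := by
  rw [ENNReal.toReal_rpow, ← ENNReal.toReal_mul]
  refine ENNReal.toReal_le_of_le_ofReal hc ?_
  calc x * a ^ s ≤ ENNReal.ofReal c * a ^ (-s) * a ^ s := by gcongr
    _ = ENNReal.ofReal c * ((a ^ s)⁻¹ * a ^ s) := by rw [mul_assoc, ENNReal.rpow_neg]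
    _ ≤ ENNReal.ofReal c * 1 := by gcongr; exact ENNReal.inv_mul_le_one _
    _ = _ := mul_one _

/-- Split `a = a ^ s * a ^ β * a ^ (1 - s - β)`: the first factor pays for the local distance, the
second for property (D), and the third is bounded by `A`. -/
theorem mul_le_of_mul_rpow_le {a A l φ L c s β : ℝ} (ha : 0 ≤ a) (haA : a ≤ A) (hA : 1 ≤ A)
    (hl : 0 ≤ l) (hφ : 0 ≤ φ) (hs : 0 ≤ s) (hβ : 0 ≤ β) (hsβ : s + β ≤ 1)
    (h1 : l * a ^ s ≤ L) (h2 : φ * a ^ β ≤ c) : a * (l * (φ + 1)) ≤ L * (c + A) * A := by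
  have hpow : ∀ t : ℝ, 0 ≤ t → t ≤ 1 → a ^ t ≤ A := fun t ht0 ht1 =>
    (Real.rpow_le_rpow ha haA ht0).trans
      ((Real.rpow_le_rpow_of_exponent_le hA ht1).trans_eq (Real.rpow_one A))
  have h3 : a = a ^ s * a ^ β * a ^ (1 - s - β) := by
    rw [← Real.rpow_add_of_nonneg ha hs hβ,
      ← Real.rpow_add_of_nonneg ha (by linarith) (by linarith)]
    ring_nf
    exact (Real.rpow_one a).symm
  have hL : 0 ≤ L := le_trans (by positivity) h1
  have hc : 0 ≤ c := le_trans (by positivity) h2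
  calc a * (l * (φ + 1)) = a ^ s * a ^ β * a ^ (1 - s - β) * (l * (φ + 1)) := by rw [← h3]
    _ = (l * a ^ s) * (φ * a ^ β + a ^ β) * a ^ (1 - s - β) := by ring
    _ ≤ L * (c + A) * A := by
      gcongr
      · exact hpow β hβ (by linarith)
      · exact hpow _ (by linarith) (by linarith)

end Approximation

end LocalDist

/-! ### The theorem. -/

theorem theorem2p8
    {𝕜 : Type*} [RCLike 𝕜]
    {X : Type*} [NormedAddCommGroup X] [NormedSpace 𝕜 X] [CompleteSpace X]
    [TopologicalSpace.SeparableSpace X]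
    {Y : Type*} [NormedAddCommGroup Y] [NormedSpace 𝕜 Y] [CompleteSpace Y]
    [TopologicalSpace.SeparableSpace Y]
    (hX : LocalDist.IsReflexive 𝕜 X) (hY : LocalDist.IsReflexive 𝕜 Y)
    (C : ℝ) (hC : 1 ≤ C) (K : ℕ → ℕ) (hK : MonotoneOn K (Set.Ici 1))
    (hfin : ∀ n : ℕ, 1 ≤ n →
      LocalDist.localDist 𝕜 K C (StrongDual 𝕜 X) (StrongDual 𝕜 Y) n < ∞)
    (T : X →L[𝕜] X) (hT : IsCompactOperator T)
    (m : ℕ → ℕ) (hm0 : m 0 = 2) (hm : ∀ k : ℕ, 1 ≤ k → K (4 * m (k - 1) + 2) + 1 ≤ m k)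
    (α β C' : ℝ) (hα₀ : 0 ≤ α) (hα : α < 1 / 4) (hβ₀ : 0 ≤ β) (hβ : β < 1 / 4) (hC' : 0 < C')
    (fX fY : ℕ → ℝ≥0) (dX DX dY DY : ℝ)
    (hDX : LocalDist.PropertyD 𝕜 X fX dX DX) (hDY : LocalDist.PropertyD 𝕜 Y fY dY DY)
    (hfX : ∀ k : ℕ, 1 ≤ k → ∀ n : ℕ, 1 ≤ n → n ≤ m (k + 1) →
      (fX n : ℝ≥0∞) ≤ ENNReal.ofReal C' * LocalDist.approxNumber T (m (k - 1)) ^ (-α))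
    (hfY : ∀ k : ℕ, 1 ≤ k → ∀ n : ℕ, 1 ≤ n → n ≤ m (k + 1) →
      (fY n : ℝ≥0∞) ≤ ENNReal.ofReal C' * LocalDist.approxNumber T (m (k - 1)) ^ (-β))
    (hld : ∀ k : ℕ, 1 ≤ k →
      LocalDist.localDist 𝕜 K C (StrongDual 𝕜 X) (StrongDual 𝕜 Y) (4 * m (k + 1)) ≤
        ENNReal.ofReal (C' * (k : ℝ) ^ (-(3 / 4) : ℝ) *
            (LocalDist.growthConst C (max (max dX dY) 1) (max DX DY) (k + 2) ^ 5)⁻¹) *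
          LocalDist.approxNumber T (m k) ^ ((-1 + 4 * max α β) / 4)) :
    ∃ (T₁ : X →L[𝕜] Y) (T₂ : Y →L[𝕜] X),
      T = T₂ ∘L T₁ ∧ DenseRange T₁ ∧ IsCompactOperator T₁ ∧ IsCompactOperator T₂ := by
  -- Finite local distance forces the duals to be finite dimensional together, and by property (D)
  -- both spaces are then zero.
  by_cases hYfin : FiniteDimensional 𝕜 Y
  · have hXfin : FiniteDimensional 𝕜 X := by
      by_contra hXinf
      exact LocalDist.not_finiteDimensional_right hfin
        (mt LocalDist.finiteDimensional_strongDual_iff.1 hXinf)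
        (LocalDist.finiteDimensional_strongDual_iff.2 hYfin)
    have := hDX.subsingleton hXfin
    have := hDY.subsingleton hYfin
    refine ⟨0, 0, Subsingleton.elim _ _, fun y => ?_, isCompactOperator_zero,
      isCompactOperator_zero⟩
    exact subset_closure ⟨0, Subsingleton.elim _ _⟩
  have hYd := mt (LocalDist.finiteDimensional_strongDual_iff (𝕜 := 𝕜)).1 hYfin
  have hXinf : ¬ FiniteDimensional 𝕜 X :=
    mt LocalDist.finiteDimensional_strongDual_iff.2 (LocalDist.not_finiteDimensional_left hfin hYd)
  have hYnt : Nontrivial Y := by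
    by_contra h
    rw [not_nontrivial_iff_subsingleton] at h
    exact hYfin inferInstance
  set d := max (max dX dY) 1
  set D := max DX DY
  have hd : 1 ≤ d := le_max_right _ _
  have hD : 1 ≤ D := hDY.one_le.trans (le_max_right _ _)
  have hDY' : LocalDist.PropertyD 𝕜 Y fY d D :=
    hDY.mono_const ((le_max_right _ _).trans (le_max_left _ _)) (le_max_right _ _)
  have hm1 : ∀ k, 1 ≤ m k := by
    intro k
    rcases k with _ | k
    · omega
    · have := hm (k + 1) (by omega); omega
  have hKm : ∀ k, K (4 * m (k + 1)) + 1 ≤ m (k + 2) := by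
    intro k
    have h1 := hm (k + 2) (by omega)
    have h2 : K (4 * m (k + 1)) ≤ K (4 * m (k + 1) + 2) :=
      hK (by have := hm1 (k + 1); simp; omega) (by simp) (by omega)
    change K (4 * m (k + 1) + 2) + 1 ≤ m (k + 2) at h1
    omega
  have hl1 : ∀ k, 1 ≤ LocalDist.localDist 𝕜 K C (StrongDual 𝕜 X) (StrongDual 𝕜 Y)
      (4 * m (k + 1)) := fun k =>
    LocalDist.one_le_localDist (by have := hm1 (k + 1); omega) hYd
  have hltop : ∀ k, LocalDist.localDist 𝕜 K C (StrongDual 𝕜 X) (StrongDual 𝕜 Y)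
      (4 * m (k + 1)) ≠ ∞ := fun k => (hfin _ (by have := hm1 (k + 1); omega)).ne
  set ld : ℕ → ℝ := fun k => (LocalDist.localDist 𝕜 K C (StrongDual 𝕜 X) (StrongDual 𝕜 Y)
      (4 * m (k + 1))).toReal
  have hld1 : ∀ k, 1 ≤ ld k := fun k => by
    simpa using ENNReal.toReal_mono (hltop k) (hl1 k)
  have hex : ∀ k, ∃ f : ℝ≥0, (f : ℝ) ≤ 2 * ld k ∧ LocalDist.LocalDistBound 𝕜 K C
      (StrongDual 𝕜 X) (StrongDual 𝕜 Y) (4 * m (k + 1)) f := by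
    -- The infimum defining the local distance need not be attained; since it is finite and at least
    -- 1, some admissible number lies below twice its value.
    intro k
    obtain ⟨f, hf, hfb⟩ := LocalDist.exists_localDistBound (b := ENNReal.ofReal (2 * ld k)) (by
      rw [ENNReal.lt_ofReal_iff_toReal_lt (hltop k)]
      have := hld1 k
      change ld k < 2 * ld k
      linarith)
    refine ⟨f, ?_, hfb⟩
    rw [← ENNReal.ofReal_coe_nnreal, ENNReal.ofReal_lt_ofReal_iff'] at hf
    exact hf.1.le
  choose ℓ hℓ hℓb using hex
  set g : ℕ → ℝ := LocalDist.growthConst C d D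
  have hg1 : ∀ k, 1 ≤ g k := LocalDist.one_le_growthConst hC hd hD
  set W : ℕ → ℝ := fun k => ((1 + 2 * C) * g k) * (D * ((1 + 2 * C) * g k) ^ d)
  have hW1 : ∀ k, 1 ≤ W k := by
    intro k
    have h1 : 1 ≤ (1 + 2 * C) * g k := by nlinarith [hg1 k]
    exact one_le_mul_of_one_le_of_one_le h1
      (one_le_mul_of_one_le_of_one_le hD (Real.one_le_rpow h1 (by linarith)))
  set B : ℕ → ℝ := fun k => (1 + C) * C ^ 2 * W k * ((ℓ k + 1) * (fY (m (k + 2)) + 1))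
  have hB1 : ∀ k, 1 ≤ B k := by
    intro k
    refine one_le_mul_of_one_le_of_one_le (one_le_mul_of_one_le_of_one_le
      (one_le_mul_of_one_le_of_one_le (by linarith) (one_le_pow₀ hC)) (hW1 k))
      (one_le_mul_of_one_le_of_one_le (by simp) (by simp))
  set a : ℕ → ℝ := fun k => (LocalDist.approxNumber T (m k)).toReal
  set A := max ‖T‖ 1
  set s := (1 - 4 * max α β) / 4
  have hs : 0 ≤ s := by
    have : max α β < 1 / 4 := max_lt hα hβ
    simp only [s]
    linarith
  have hsβ : s + β ≤ 1 := by
    have : 0 ≤ max α β := hα₀.trans (le_max_left _ _)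
    simp only [s]
    linarith
  have hldk : ∀ k, 1 ≤ k → ld k * a k ^ s ≤ C' * (g (k + 2) ^ 5)⁻¹ := by
    intro k hk
    have h1 := hld k hk
    rw [show (-1 + 4 * max α β) / 4 = -s by simp only [s]; ring] at h1
    have hgk := hg1 (k + 2)
    refine (LocalDist.toReal_mul_rpow_le (by positivity) h1).trans ?_
    -- This factor is simply bounded by 1; the summability comes from the growth constants.
    have h2 : (k : ℝ) ^ (-(3 / 4) : ℝ) ≤ 1 :=
      Real.rpow_le_one_of_one_le_of_nonpos (by exact_mod_cast hk) (by norm_num)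
    change C' * (k : ℝ) ^ (-(3 / 4) : ℝ) * (g (k + 2) ^ 5)⁻¹ ≤ _
    gcongr
    exact mul_le_of_le_one_right hC'.le h2
  have hfk : ∀ k, fY (m (k + 2)) * a k ^ β ≤ C' := by
    intro k
    exact LocalDist.toReal_mul_rpow_le hC'.le
      (hfY (k + 1) (by omega) (m (k + 2)) (hm1 _) le_rfl)
  -- The added 1 makes the bound on `a k * B k` strict, leaving room to choose `G k` of finite rank
  -- near the infimum even when `a k = 0`.
  set c₀ := 3 * (C' * (C' + A) * A) + 1
  have hA1 : 1 ≤ A := le_max_right _ _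
  have hc₀ : 0 < c₀ := by positivity
  have haB : ∀ k, 1 ≤ k → a k * B k < c₀ * (1 / 4) ^ k := by
    intro k hk
    have ha : 0 ≤ a k := ENNReal.toReal_nonneg
    have hgk := hg1 (k + 2)
    have h1 := LocalDist.mul_le_of_mul_rpow_le ha
      ((LocalDist.toReal_approxNumber_le T (hm1 k)).trans (le_max_left ‖T‖ 1)) hA1
      (zero_le_one.trans (hld1 k)) (fY (m (k + 2))).coe_nonneg hs hβ₀ hsβ (hldk k hk) (hfk k)
    have h2 : (1 + C) * C ^ 2 * W k ≤ g (k + 2) ^ 3 := LocalDist.growthConst_bound hC hd hD k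
    have h3 : (ℓ k : ℝ) + 1 ≤ 3 * ld k := by linarith [hℓ k, hld1 k]
    have h4 : g (k + 2) ^ 3 * (g (k + 2) ^ 5)⁻¹ ≤ (1 / 4) ^ k :=
      LocalDist.growthConst_decay hC hd hD k
    calc a k * B k ≤ a k * (g (k + 2) ^ 3 * (3 * ld k * (fY (m (k + 2)) + 1))) := by
          simp only [B]
          gcongr
      _ = 3 * g (k + 2) ^ 3 * (a k * (ld k * (fY (m (k + 2)) + 1))) := by ring
      _ ≤ 3 * g (k + 2) ^ 3 * (C' * (g (k + 2) ^ 5)⁻¹ * (C' + A) * A) := by gcongr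
      _ = 3 * (C' * (C' + A) * A) * (g (k + 2) ^ 3 * (g (k + 2) ^ 5)⁻¹) := by ring
      _ ≤ 3 * (C' * (C' + A) * A) * (1 / 4) ^ k := by gcongr
      _ < c₀ * (1 / 4) ^ k := by
        gcongr
        simp [c₀]
  have hGex : ∀ k, ∃ G : X →L[𝕜] X, LocalDist.RankLE G (m k) ∧ (k = 0 → G = 0) ∧
      (1 ≤ k → ‖T - G‖ * B k ≤ c₀ * (1 / 4) ^ k) := by
    intro k
    have hBk : 0 < B k := zero_lt_one.trans_le (hB1 k)
    rcases Nat.eq_zero_or_pos k with rfl | hk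
    · exact ⟨0, LocalDist.rankLE_zero _, fun _ => rfl, fun h => absurd h (by norm_num)⟩
    · obtain ⟨G, hG, hTG⟩ := LocalDist.exists_rankLE_norm_sub_lt T (hm1 k)
        ((lt_div_iff₀ hBk).2 (haB k hk))
      exact ⟨G, hG, by omega, fun _ => ((lt_div_iff₀ hBk).1 hTG).le⟩
  choose G hGr hG0 hGB using hGex
  -- The growth hypothesis starts at `k = 1`, so the block `k = 0`, with `G 0 = 0`, is absorbed into
  -- the constant.
  have hGB' : ∀ k, ‖T - G k‖ * B k ≤ (c₀ + ‖T‖ * B 0) * (1 / 4) ^ k := by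
    intro k
    have hB0 := zero_le_one.trans (hB1 0)
    rcases Nat.eq_zero_or_pos k with rfl | hk
    · rw [hG0 0 rfl]
      simpa using hc₀.le
    · refine (hGB k hk).trans ?_
      gcongr
      have : 0 ≤ ‖T‖ * B 0 := by positivity
      linarith
  have hGT : Filter.Tendsto G Filter.atTop (nhds T) := by
    rw [tendsto_iff_norm_sub_tendsto_zero]
    have h1 : Filter.Tendsto (fun k : ℕ => (c₀ + ‖T‖ * B 0) * (1 / 4 : ℝ) ^ k) Filter.atTop
        (nhds 0) := by
      simpa using (tendsto_pow_atTop_nhds_zero_of_lt_one (r := (1 / 4 : ℝ)) (by norm_num)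
        (by norm_num)).const_mul (c₀ + ‖T‖ * B 0)
    refine squeeze_zero (fun _ => norm_nonneg _) (fun k => ?_) h1
    rw [norm_sub_rev]
    exact (le_mul_of_one_le_right (norm_nonneg _) (hB1 k)).trans (hGB' k)
  obtain ⟨T₁, T₂, hT₁₂⟩ := LocalDist.exists_isFactorization_of_bounds hX hY
    (zero_le_one.trans hC) hDY' T G hℓb (fun k => (Nat.le_succ _).trans (hKm k))
    (fun k => by
      -- Infinite dimension of the dual of `Y` gives `n ≤ K n`, hence `4 * m (k + 1) ≤ m (k + 2)`.
      obtain ⟨N, -, h1, h2, -⟩ := (hℓb k).le_right hYd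
      exact (h1.trans h2).trans ((Nat.le_succ _).trans (hKm k)))
    hg1 (LocalDist.growthConst_step hC hd hD) (hG0 0 rfl) hGr
    (c := c₀ + ‖T‖ * B 0)
    (by have := zero_le_one.trans (hB1 0); positivity) hGT (fun k => by
      refine le_trans (le_of_eq ?_) (hGB' k)
      simp only [B, W]
      ring)
  obtain ⟨S₁, S₂, hS, hdense⟩ := hT₁₂.exists_denseRange hXinf
  exact ⟨S₁, S₂, hS.comp_eq.symm, hdense, hS.compact_left, hS.compact_right⟩
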